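/- For $a\in\mathbb R^3$ let $[a]_\times$ be the skew-symmetric $3\times3$ matrix with $[a]_\times b=a\times b$ for all $b\in\mathbb R^3$, and for $3\times 3$ matrices $A,B$ let $A^*$ be the adjugate of $A$ and $A\diamond B=(A-B)^*-A^*-B^*$. An essential matrix is a real matrix of the form $R_2[R_2^\top t_2-R_1^\top t_1]_\times R_1^\top$ with $R_1,R_2\in\mathrm{SO}(3)$ and $t_1,t_2\in\mathbb R^3$. Let $E_{12},E_{23},E_{31}$ be essential matrices of rank two. Put $E_{21}=E_{12}^\top$, $E_{32}=E_{23}^\top$, $E_{13}=E_{31}^\top$ and $$E=\begin{bmatrix}0_{3\times 3}&E_{12}&E_{13}\\E_{21}&0_{3\times 3}&E_{23}\\E_{31}&E_{32}&0_{3\times 3}\end{bmatrix}.$$ The triplet $\{E_{12},E_{23},E_{31}\}$ is compatible, i.e. there are $R_1,R_2,R_3\in\mathrm{SO}(3)$ and $b_1,b_2,b_3\in\mathbb R^3$ with $E_{ij}=R_i[b_i-b_j]_\times R_j^\top$ for all distinct $i,j\in\{1,2,3\}$, if and only if the following equations hold for all distinct $i,j,k\in\{1,2,3\}$: $$\operatorname{tr}(E_{12}E_{23}E_{31})=0,$$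 $$E_{ij}^\top E_{ij}E_{jk}-\tfrac12\operatorname{tr}(E_{ij}^\top E_{ij})\,E_{jk}+E_{ij}^*E_{ki}^\top=0_{3\times3},$$ $$E_{jk}^\top E_{ij}^*+E_{jk}^*E_{ij}^\top+(E_{ij}E_{jk})\diamond E_{ki}^\top=0_{3\times3},$$ $$\bigl(\operatorname{tr}(E^2)\bigr)^2-16\operatorname{tr}(E^4)+24\sum_{1\le i<j\le3}\bigl(\operatorname{tr}(E_{ij}^\top E_{ij})\bigr)^2=0,$$ $$\bigl(\operatorname{tr}(E^2)\bigr)^3-12\operatorname{tr}(E^2)\operatorname{tr}(E^4)+32\operatorname{tr}(E^6)=0.$$ No assumption is made on the position of $b_1,b_2,b_3$; in particular they may be collinear. -/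

import Mathlib

open scoped Matrix

namespace EssentialTriplet

/-- The skew-symmetric matrix `[a]_×` of a `3`-vector `a`. -/
def crossMatrix (a : Fin 3 → ℝ) : Matrix (Fin 3) (Fin 3) ℝ :=
  !![0, -a 2, a 1; a 2, 0, -a 0; -a 1, a 0, 0]

/-- `[a]_× b = a × b`. -/
theorem crossMatrix_mulVec (a b : Fin 3 → ℝ) : crossMatrix a *ᵥ b = crossProduct a b := by
  ext i
  fin_cases i <;> simp [crossMatrix, cross_apply, Matrix.mulVec, dotProduct, Fin.sum_univ_three] <;>
    ring

/-- Essential matrices (possibly degenerate, the rank is not restricted here): the matrices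
`R₂ [R₂ᵀ t₂ - R₁ᵀ t₁]_× R₁ᵀ` of two calibrated cameras `[R₁ t₁]` and `[R₂ t₂]`. -/
def IsEssential (E : Matrix (Fin 3) (Fin 3) ℝ) : Prop :=
  ∃ R₁ ∈ Matrix.specialOrthogonalGroup (Fin 3) ℝ, ∃ R₂ ∈ Matrix.specialOrthogonalGroup (Fin 3) ℝ,
    ∃ t₁ t₂ : Fin 3 → ℝ, E = R₂ * crossMatrix (R₂ᵀ *ᵥ t₂ - R₁ᵀ *ᵥ t₁) * R₁ᵀ

/-- The blocks `E_ij` of a triplet `E₁₂, E₂₃, E₃₁`, with `E_ji = E_ijᵀ` and `E_ii = 0`.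
The views `1, 2, 3` are the indices `0, 1, 2`. -/
def block (E₁₂ E₂₃ E₃₁ : Matrix (Fin 3) (Fin 3) ℝ) :
    Fin 3 → Fin 3 → Matrix (Fin 3) (Fin 3) ℝ :=
  ![![0, E₁₂, E₃₁ᵀ],
    ![E₁₂ᵀ, 0, E₂₃],
    ![E₃₁, E₂₃ᵀ, 0]]

/-- The symmetric `9 × 9` matrix with the blocks `E_ij`. -/
def bigMatrix (E₁₂ E₂₃ E₃₁ : Matrix (Fin 3) (Fin 3) ℝ) :
    Matrix (Fin 3 × Fin 3) (Fin 3 × Fin 3) ℝ :=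
  Matrix.of fun p q => block E₁₂ E₂₃ E₃₁ p.1 q.1 p.2 q.2

/-- Compatibility of a triplet: `E_ij = R_i [b_i - b_j]_× R_jᵀ` for all distinct `i, j`. -/
def IsCompatible (E₁₂ E₂₃ E₃₁ : Matrix (Fin 3) (Fin 3) ℝ) : Prop :=
  ∃ (R : Fin 3 → Matrix (Fin 3) (Fin 3) ℝ) (b : Fin 3 → Fin 3 → ℝ),
    (∀ i, R i ∈ Matrix.specialOrthogonalGroup (Fin 3) ℝ) ∧
      ∀ i j, i ≠ j → block E₁₂ E₂₃ E₃₁ i j = R i * crossMatrix (b i - b j) * (R j)ᵀ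

/-- The operation `A ⋄ B = (A - B)^* - A^* - B^*`, where `^*` is the adjugate. -/
def diamond (A B : Matrix (Fin 3) (Fin 3) ℝ) : Matrix (Fin 3) (Fin 3) ℝ :=
  (A - B).adjugate - A.adjugate - B.adjugate

end EssentialTriplet

open EssentialTriplet

namespace EssentialTriplet

/-! Both sides are unchanged when the views get new frames `Q i` in SO(3), so a triplet may be put
in normal form. If it is compatible, its baselines sum to zero and hence lie in a plane. The matrix
equations become identities between cross products, and the trace equations become polynomial
identities in planar coordinates.

Conversely, choose frames with E₁₂ = [a]ₓ and E₂₃ = [b]ₓ, where a = (α, 0, 0) and b = (β₁, β₂, 0),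
and call the third block C. Since EᵀE − ½tr(EᵀE) = −yyᵀ and E* = yxᵀ for the epipoles x, y of E, the
cubic equations collapse to vector relations between the blocks and their epipoles.

If β₂ ≠ 0, they force C to be `normalBlock u v β₂ w` with one linear and one quadratic relation. The
quartic equation then factors and leaves two values for u² + v² (`quarticForm_eq`); the sextic
correlates two remaining signs (`sexticForm_eq`). Every survivor comes from a closed triangle with
sides ±a, ±b by half turns about a or b, which only negate [a]ₓ or [b]ₓ.

If β₂ = 0, the cubic equations and tr(E₁₂E₂₃E₃₁) = 0 reduce C to a traceless 2×2 block proportional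
to an orthogonal matrix. The sextic excludes reflections, so C = [γe₁]ₓ. The quartic then makes some
±α ± β ± γ vanish, and half turns about e₁ adjust the signs. -/

/-- The polynomial equations on a family of blocks `M i j` that characterize compatibility. -/
def CompatibilityEquations (M : Fin 3 → Fin 3 → Matrix (Fin 3) (Fin 3) ℝ) : Prop :=
  (M 0 1 * M 1 2 * M 2 0).trace = 0 ∧
  (∀ i j k : Fin 3, i ≠ j → j ≠ k → k ≠ i →
    (M i j)ᵀ * M i j * M j k - ((1 / 2 : ℝ) * ((M i j)ᵀ * M i j).trace) • M j k
      + (M i j).adjugate * (M k i)ᵀ = 0) ∧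
  (∀ i j k : Fin 3, i ≠ j → j ≠ k → k ≠ i →
    (M j k)ᵀ * (M i j).adjugate + (M j k).adjugate * (M i j)ᵀ
      + diamond (M i j * M j k) (M k i)ᵀ = 0) ∧
  ((Matrix.of fun p q : Fin 3 × Fin 3 => M p.1 q.1 p.2 q.2) ^ 2).trace ^ 2
      - 16 * ((Matrix.of fun p q : Fin 3 × Fin 3 => M p.1 q.1 p.2 q.2) ^ 4).trace
      + 24 * (∑ i : Fin 3, ∑ j ∈ Finset.Ioi i, ((M i j)ᵀ * M i j).trace ^ 2) = 0 ∧
  ((Matrix.of fun p q : Fin 3 × Fin 3 => M p.1 q.1 p.2 q.2) ^ 2).trace ^ 3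
      - 12 * ((Matrix.of fun p q : Fin 3 × Fin 3 => M p.1 q.1 p.2 q.2) ^ 2).trace
          * ((Matrix.of fun p q : Fin 3 × Fin 3 => M p.1 q.1 p.2 q.2) ^ 4).trace
      + 32 * ((Matrix.of fun p q : Fin 3 × Fin 3 => M p.1 q.1 p.2 q.2) ^ 6).trace = 0

/-! ### Invariance under changes of frame -/

/-- Change of the coordinate frames of the three views. -/
def conjBlocks (Q : Fin 3 → Matrix (Fin 3) (Fin 3) ℝ)
    (M : Fin 3 → Fin 3 → Matrix (Fin 3) (Fin 3) ℝ) :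
    Fin 3 → Fin 3 → Matrix (Fin 3) (Fin 3) ℝ :=
  fun i j => Q i * M i j * (Q j)ᵀ

theorem mem_SO3_iff {Q : Matrix (Fin 3) (Fin 3) ℝ} :
    Q ∈ Matrix.specialOrthogonalGroup (Fin 3) ℝ ↔ Qᵀ * Q = 1 ∧ Q.det = 1 := by
  rw [Matrix.mem_specialOrthogonalGroup_iff, Matrix.mem_orthogonalGroup_iff']

theorem SO3_transpose_mul {Q : Matrix (Fin 3) (Fin 3) ℝ}
    (hQ : Q ∈ Matrix.specialOrthogonalGroup (Fin 3) ℝ) : Qᵀ * Q = 1 :=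
  (mem_SO3_iff.1 hQ).1

theorem SO3_mul_transpose {Q : Matrix (Fin 3) (Fin 3) ℝ}
    (hQ : Q ∈ Matrix.specialOrthogonalGroup (Fin 3) ℝ) : Q * Qᵀ = 1 :=
  mul_eq_one_comm.1 (SO3_transpose_mul hQ)

theorem SO3_transpose_mul_cancel {Q : Matrix (Fin 3) (Fin 3) ℝ}
    (hQ : Q ∈ Matrix.specialOrthogonalGroup (Fin 3) ℝ) (X : Matrix (Fin 3) (Fin 3) ℝ) :
    Qᵀ * (Q * X) = X := by
  rw [← mul_assoc, SO3_transpose_mul hQ, one_mul]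

theorem SO3_transpose {Q : Matrix (Fin 3) (Fin 3) ℝ}
    (hQ : Q ∈ Matrix.specialOrthogonalGroup (Fin 3) ℝ) :
    Qᵀ ∈ Matrix.specialOrthogonalGroup (Fin 3) ℝ := by
  rw [mem_SO3_iff, Matrix.transpose_transpose, Matrix.det_transpose]
  exact ⟨SO3_mul_transpose hQ, (mem_SO3_iff.1 hQ).2⟩

theorem SO3_adjugate {Q : Matrix (Fin 3) (Fin 3) ℝ}
    (hQ : Q ∈ Matrix.specialOrthogonalGroup (Fin 3) ℝ) : Q.adjugate = Qᵀ := by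
  have h : Q * Q.adjugate = 1 := by
    rw [Matrix.mul_adjugate, (mem_SO3_iff.1 hQ).2, one_smul]
  calc Q.adjugate = Qᵀ * (Q * Q.adjugate) := (SO3_transpose_mul_cancel hQ _).symm
    _ = Qᵀ := by rw [h, mul_one]

theorem SO3_adjugate_conj {P Q : Matrix (Fin 3) (Fin 3) ℝ}
    (hP : P ∈ Matrix.specialOrthogonalGroup (Fin 3) ℝ)
    (hQ : Q ∈ Matrix.specialOrthogonalGroup (Fin 3) ℝ) (X : Matrix (Fin 3) (Fin 3) ℝ) :
    (P * X * Qᵀ).adjugate = Q * X.adjugate * Pᵀ := by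
  rw [Matrix.adjugate_mul_distrib, Matrix.adjugate_mul_distrib, SO3_adjugate hP,
    SO3_adjugate (SO3_transpose hQ), Matrix.transpose_transpose, mul_assoc]

theorem diamond_conj {P Q : Matrix (Fin 3) (Fin 3) ℝ}
    (hP : P ∈ Matrix.specialOrthogonalGroup (Fin 3) ℝ)
    (hQ : Q ∈ Matrix.specialOrthogonalGroup (Fin 3) ℝ) (X Y : Matrix (Fin 3) (Fin 3) ℝ) :
    diamond (P * X * Qᵀ) (P * Y * Qᵀ) = Q * diamond X Y * Pᵀ := by
  have h : P * X * Qᵀ - P * Y * Qᵀ = P * (X - Y) * Qᵀ := by noncomm_ring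
  simp only [diamond, h, SO3_adjugate_conj hP hQ]
  noncomm_ring

theorem trace_transpose_mul_conj {P Q : Matrix (Fin 3) (Fin 3) ℝ}
    (hP : P ∈ Matrix.specialOrthogonalGroup (Fin 3) ℝ)
    (hQ : Q ∈ Matrix.specialOrthogonalGroup (Fin 3) ℝ) (X : Matrix (Fin 3) (Fin 3) ℝ) :
    ((P * X * Qᵀ)ᵀ * (P * X * Qᵀ)).trace = (Xᵀ * X).trace := by
  have h : (P * X * Qᵀ)ᵀ * (P * X * Qᵀ) = Q * (Xᵀ * X * Qᵀ) := by
    simp only [Matrix.transpose_mul, Matrix.transpose_transpose, mul_assoc,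
      SO3_transpose_mul_cancel hP]
  rw [h, Matrix.trace_mul_comm, mul_assoc, SO3_transpose_mul hQ, mul_one]

theorem trace_flatten_conjBlocks_pow {Q : Fin 3 → Matrix (Fin 3) (Fin 3) ℝ}
    (hQ : ∀ i, Q i ∈ Matrix.specialOrthogonalGroup (Fin 3) ℝ)
    (M : Fin 3 → Fin 3 → Matrix (Fin 3) (Fin 3) ℝ) (n : ℕ) :
    ((Matrix.of fun p q : Fin 3 × Fin 3 => conjBlocks Q M p.1 q.1 p.2 q.2) ^ n).trace =
      ((Matrix.of fun p q : Fin 3 × Fin 3 => M p.1 q.1 p.2 q.2) ^ n).trace := by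
  set N : Matrix (Fin 3 × Fin 3) (Fin 3 × Fin 3) ℝ := Matrix.of fun p q => M p.1 q.1 p.2 q.2
    with hN
  -- Over the ring of 3×3 blocks, the change of frames is conjugation by a block diagonal matrix.
  let φ := Matrix.compRingEquiv (Fin 3) (Fin 3) ℝ
  let D : Matrix (Fin 3) (Fin 3) (Matrix (Fin 3) (Fin 3) ℝ) := Matrix.diagonal Q
  let D' : Matrix (Fin 3) (Fin 3) (Matrix (Fin 3) (Fin 3) ℝ) :=
    Matrix.diagonal fun i => (Q i)ᵀ
  have hD : D' * D = 1 := by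
    simp only [D, D', Matrix.diagonal_mul_diagonal, SO3_transpose_mul (hQ _)]
    exact Matrix.diagonal_one
  have hφ : φ D' * φ D = 1 := by rw [← map_mul, hD, map_one]
  have hc : (Matrix.of fun p q : Fin 3 × Fin 3 => conjBlocks Q M p.1 q.1 p.2 q.2) =
      φ D * N * φ D' := by
    have h1 : N = φ (Matrix.of M) := rfl
    rw [h1, ← map_mul, ← map_mul]
    ext p q
    show conjBlocks Q M p.1 q.1 p.2 q.2 =
      (Matrix.diagonal Q * Matrix.of M * Matrix.diagonal fun i => (Q i)ᵀ) p.1 q.1 p.2 q.2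
    rw [Matrix.mul_diagonal, Matrix.diagonal_mul]
    rfl
  have hp : ∀ n, (φ D * N * φ D') ^ n = φ D * N ^ n * φ D' := by
    intro n
    induction n with
    | zero => rw [pow_zero, pow_zero, mul_one, mul_eq_one_comm.1 hφ]
    | succ k ih =>
      rw [pow_succ, ih, pow_succ]
      calc φ D * N ^ k * φ D' * (φ D * N * φ D')
          = φ D * N ^ k * (φ D' * φ D) * N * φ D' := by noncomm_ring
        _ = _ := by rw [hφ]; noncomm_ring
  rw [hc, hp, Matrix.trace_mul_comm, ← mul_assoc, hφ, one_mul]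

theorem CompatibilityEquations.conjBlocks {M : Fin 3 → Fin 3 → Matrix (Fin 3) (Fin 3) ℝ}
    (h : CompatibilityEquations M) {Q : Fin 3 → Matrix (Fin 3) (Fin 3) ℝ}
    (hQ : ∀ i, Q i ∈ Matrix.specialOrthogonalGroup (Fin 3) ℝ) :
    CompatibilityEquations (conjBlocks Q M) := by
  obtain ⟨h1, h2, h3, h4, h5⟩ := h
  refine ⟨?_, ?_, ?_, ?_, ?_⟩
  · have e : EssentialTriplet.conjBlocks Q M 0 1 * EssentialTriplet.conjBlocks Q M 1 2 *
        EssentialTriplet.conjBlocks Q M 2 0 = Q 0 * (M 0 1 * M 1 2 * M 2 0 * (Q 0)ᵀ) := by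
      simp only [EssentialTriplet.conjBlocks, mul_assoc, SO3_transpose_mul_cancel (hQ _)]
    rw [e, Matrix.trace_mul_comm, mul_assoc, SO3_transpose_mul (hQ _), mul_one, h1]
  · intro i j k hij hjk hki
    have e := congrArg (fun X => Q j * X * (Q k)ᵀ) (h2 i j k hij hjk hki)
    simp only [mul_zero, zero_mul] at e
    rw [← e]
    simp only [EssentialTriplet.conjBlocks, SO3_adjugate_conj (hQ _) (hQ _),
      trace_transpose_mul_conj (hQ _) (hQ _)]
    simp only [Matrix.transpose_mul, Matrix.transpose_transpose, mul_assoc,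
      SO3_transpose_mul_cancel (hQ _), mul_add, add_mul, mul_sub, sub_mul, Matrix.smul_mul,
      Matrix.mul_smul]
  · intro i j k hij hjk hki
    have e := congrArg (fun X => Q k * X * (Q i)ᵀ) (h3 i j k hij hjk hki)
    simp only [mul_zero, zero_mul] at e
    rw [← e]
    have e1 : EssentialTriplet.conjBlocks Q M i j * EssentialTriplet.conjBlocks Q M j k =
        Q i * (M i j * M j k) * (Q k)ᵀ := by
      simp only [EssentialTriplet.conjBlocks, mul_assoc, SO3_transpose_mul_cancel (hQ _)]
    have e2 : (EssentialTriplet.conjBlocks Q M k i)ᵀ = Q i * (M k i)ᵀ * (Q k)ᵀ := by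
      simp only [EssentialTriplet.conjBlocks, Matrix.transpose_mul, Matrix.transpose_transpose,
        mul_assoc]
    rw [e1, e2, diamond_conj (hQ _) (hQ _)]
    simp only [EssentialTriplet.conjBlocks, SO3_adjugate_conj (hQ _) (hQ _)]
    simp only [Matrix.transpose_mul, Matrix.transpose_transpose, mul_assoc,
      SO3_transpose_mul_cancel (hQ _), mul_add, add_mul]
  · simp only [trace_flatten_conjBlocks_pow hQ]
    simpa only [EssentialTriplet.conjBlocks, trace_transpose_mul_conj (hQ _) (hQ _)] using h4
  · simpa only [trace_flatten_conjBlocks_pow hQ] using h5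

theorem conjBlocks_block (Q : Fin 3 → Matrix (Fin 3) (Fin 3) ℝ)
    (A B C : Matrix (Fin 3) (Fin 3) ℝ) :
    conjBlocks Q (block A B C) =
      block (Q 0 * A * (Q 1)ᵀ) (Q 1 * B * (Q 2)ᵀ) (Q 2 * C * (Q 0)ᵀ) := by
  funext i j
  fin_cases i <;> fin_cases j <;> simp [conjBlocks, block, mul_assoc]

theorem isCompatible_of_conj {Q : Fin 3 → Matrix (Fin 3) (Fin 3) ℝ}
    (hQ : ∀ i, Q i ∈ Matrix.specialOrthogonalGroup (Fin 3) ℝ)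
    {A B C : Matrix (Fin 3) (Fin 3) ℝ}
    (h : IsCompatible (Q 0 * A * (Q 1)ᵀ) (Q 1 * B * (Q 2)ᵀ) (Q 2 * C * (Q 0)ᵀ)) :
    IsCompatible A B C := by
  obtain ⟨R, b, hR, h⟩ := h
  refine ⟨fun i => (Q i)ᵀ * R i, b, fun i => mul_mem (SO3_transpose (hQ i)) (hR i), ?_⟩
  intro i j hij
  have h' := h i j hij
  rw [← conjBlocks_block] at h'
  have e := congrArg (fun X => (Q i)ᵀ * X * Q j) h'
  simp only [conjBlocks, mul_assoc, SO3_transpose_mul_cancel (hQ _), SO3_transpose_mul (hQ _),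
    mul_one] at e
  rw [e]
  simp only [Matrix.transpose_mul, Matrix.transpose_transpose, mul_assoc]

/-! ### Cross-product matrices and closed triangles of baselines -/

theorem crossMatrix_conj {W : Matrix (Fin 3) (Fin 3) ℝ}
    (hW : W ∈ Matrix.specialOrthogonalGroup (Fin 3) ℝ) (v : Fin 3 → ℝ) :
    W * crossMatrix v * Wᵀ = crossMatrix (W *ᵥ v) := by
  have h : W = W.adjugateᵀ := by rw [SO3_adjugate hW, Matrix.transpose_transpose]
  -- With the cofactor matrix in place of W on the right this is a polynomial identity valid for
  -- every W; a rotation is its own cofactor matrix.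
  have key : W * crossMatrix v * Wᵀ = crossMatrix (W.adjugateᵀ *ᵥ v) := by
    rw [Matrix.adjugate_fin_three]
    ext i j
    fin_cases i <;> fin_cases j <;>
      simp [crossMatrix, Matrix.mul_apply, Matrix.mulVec, dotProduct, Fin.sum_univ_three] <;> ring
  rw [key, ← h]

theorem crossMatrix_zero : crossMatrix 0 = 0 := by
  ext i j
  fin_cases i <;> fin_cases j <;> simp [crossMatrix]

theorem crossMatrix_transpose (v : Fin 3 → ℝ) : (crossMatrix v)ᵀ = crossMatrix (-v) := by
  ext i j
  fin_cases i <;> fin_cases j <;> simp [crossMatrix]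

theorem exists_block_eq_crossMatrix_sub {a b c : Fin 3 → ℝ} (h : a + b + c = 0) :
    ∃ t : Fin 3 → Fin 3 → ℝ, ∀ i j,
      block (crossMatrix a) (crossMatrix b) (crossMatrix c) i j = crossMatrix (t i - t j) := by
  have hc : c = -a - b := by linear_combination h
  have key : ∀ t : Fin 3 → Fin 3 → ℝ, t 0 - t 1 = a → t 1 - t 2 = b → t 2 - t 0 = c → ∀ i j,
      block (crossMatrix a) (crossMatrix b) (crossMatrix c) i j = crossMatrix (t i - t j) := by
    rintro t rfl rfl rfl i j
    fin_cases i <;> fin_cases j <;>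
      simp [block, crossMatrix_transpose, crossMatrix_zero]
  refine ⟨![0, -a, -a - b], key _ ?_ ?_ ?_⟩
  · simp
  · simp
  · simp [hc]

theorem isCompatible_of_add_eq_zero {R : Fin 3 → Matrix (Fin 3) (Fin 3) ℝ}
    (hR : ∀ i, R i ∈ Matrix.specialOrthogonalGroup (Fin 3) ℝ) {a b c : Fin 3 → ℝ}
    (h : a + b + c = 0) :
    IsCompatible (R 0 * crossMatrix a * (R 1)ᵀ) (R 1 * crossMatrix b * (R 2)ᵀ)
      (R 2 * crossMatrix c * (R 0)ᵀ) := by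
  obtain ⟨t, ht⟩ := exists_block_eq_crossMatrix_sub h
  refine ⟨R, t, hR, fun i j _ => ?_⟩
  rw [← conjBlocks_block, conjBlocks, ht]

/-! ### Planar normal form by Givens rotations -/

theorem exists_givens (x y : ℝ) : ∃ c s : ℝ, c ^ 2 + s ^ 2 = 1 ∧ c * y - s * x = 0 := by
  by_cases h : x ^ 2 + y ^ 2 = 0
  · have hx : x = 0 := by nlinarith [sq_nonneg x, sq_nonneg y]
    have hy : y = 0 := by nlinarith [sq_nonneg x, sq_nonneg y]
    exact ⟨1, 0, by norm_num, by simp [hx, hy]⟩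
  · have hp : 0 < x ^ 2 + y ^ 2 := lt_of_le_of_ne (by positivity) (Ne.symm h)
    have hs : √(x ^ 2 + y ^ 2) ≠ 0 := (Real.sqrt_pos.2 hp).ne'
    refine ⟨x / √(x ^ 2 + y ^ 2), y / √(x ^ 2 + y ^ 2), ?_, by ring⟩
    rw [div_pow, div_pow, Real.sq_sqrt hp.le, ← add_div, div_self h]

theorem rotation01_mem {c s : ℝ} (h : c ^ 2 + s ^ 2 = 1) :
    !![c, s, 0; -s, c, 0; 0, 0, 1] ∈ Matrix.specialOrthogonalGroup (Fin 3) ℝ := by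
  rw [mem_SO3_iff]
  constructor
  · ext i j
    fin_cases i <;> fin_cases j <;> simp [Matrix.mul_apply, Fin.sum_univ_three] <;>
      first | linear_combination h | ring
  · simp [Matrix.det_fin_three]
    linear_combination h

theorem rotation12_mem {c s : ℝ} (h : c ^ 2 + s ^ 2 = 1) :
    !![1, 0, 0; 0, c, s; 0, -s, c] ∈ Matrix.specialOrthogonalGroup (Fin 3) ℝ := by
  rw [mem_SO3_iff]
  constructor
  · ext i j
    fin_cases i <;> fin_cases j <;> simp [Matrix.mul_apply, Fin.sum_univ_three] <;>
      first | linear_combination h | ring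
  · simp [Matrix.det_fin_three]
    linear_combination h

/-- This is a QR decomposition of the pair a, b. Two rotations bring a to the first axis; a last one
about that axis clears the third coordinate of b. -/
theorem exists_rotation_triangular (a b : Fin 3 → ℝ) :
    ∃ W ∈ Matrix.specialOrthogonalGroup (Fin 3) ℝ, ∃ α β₁ β₂ : ℝ,
      W *ᵥ a = ![α, 0, 0] ∧ W *ᵥ b = ![β₁, β₂, 0] := by
  obtain ⟨c₁, s₁, h₁, e₁⟩ := exists_givens (a 1) (a 2)
  obtain ⟨c₂, s₂, h₂, e₂⟩ := exists_givens (a 0) (c₁ * a 1 + s₁ * a 2)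
  set V := !![c₂, s₂, 0; -s₂, c₂, 0; 0, 0, 1] * !![1, 0, 0; 0, c₁, s₁; 0, -s₁, c₁] with hV
  have hVm : V ∈ Matrix.specialOrthogonalGroup (Fin 3) ℝ :=
    mul_mem (rotation01_mem h₂) (rotation12_mem h₁)
  obtain ⟨c₃, s₃, h₃, e₃⟩ := exists_givens ((V *ᵥ b) 1) ((V *ᵥ b) 2)
  have hVa : V *ᵥ a = ![c₂ * a 0 + s₂ * (c₁ * a 1 + s₁ * a 2), 0, 0] := by
    rw [hV, ← Matrix.mulVec_mulVec]
    ext i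
    fin_cases i <;> simp [Matrix.mulVec, dotProduct, Fin.sum_univ_three]
    · linear_combination e₂
    · linear_combination e₁
  refine ⟨!![1, 0, 0; 0, c₃, s₃; 0, -s₃, c₃] * V, mul_mem (rotation12_mem h₃) hVm,
    c₂ * a 0 + s₂ * (c₁ * a 1 + s₁ * a 2), (V *ᵥ b) 0,
    c₃ * (V *ᵥ b) 1 + s₃ * (V *ᵥ b) 2, ?_, ?_⟩
  · rw [← Matrix.mulVec_mulVec, hVa]
    ext i
    fin_cases i <;> simp [Matrix.mulVec, dotProduct, Fin.sum_univ_three]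
  · rw [← Matrix.mulVec_mulVec]
    generalize V *ᵥ b = b' at *
    ext i
    fin_cases i <;> simp [Matrix.mulVec, dotProduct, Fin.sum_univ_three]
    linear_combination e₃

/-! ### Traces of even powers in normal form -/

/-- The columns of Y are orthonormal and orthogonal to those of X, so the square splits as XXᵀ +
Y(XᵀX)Yᵀ and both summands contribute the same power traces. -/
theorem trace_bipartite_pow {ι κ : Type*} [Fintype ι] [Fintype κ] [DecidableEq ι] [DecidableEq κ]
    (X Y : Matrix ι κ ℝ) (hYX : Yᵀ * X = 0) (hYY : Yᵀ * Y = 1) (k : ℕ) :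
    ((X * Yᵀ + Y * Xᵀ) ^ (2 * (k + 1))).trace = 2 * ((Xᵀ * X) ^ (k + 1)).trace := by
  have hXY : Xᵀ * Y = 0 := by
    rw [← Matrix.transpose_eq_zero, Matrix.transpose_mul, Matrix.transpose_transpose, hYX]
  have hYXc : ∀ Z : Matrix κ ι ℝ, Yᵀ * (X * Z) = 0 := fun Z => by
    rw [← Matrix.mul_assoc, hYX, Matrix.zero_mul]
  have hXYc : ∀ Z : Matrix κ ι ℝ, Xᵀ * (Y * Z) = 0 := fun Z => by
    rw [← Matrix.mul_assoc, hXY, Matrix.zero_mul]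
  have hYYc : ∀ Z : Matrix κ ι ℝ, Yᵀ * (Y * Z) = Z := fun Z => by
    rw [← Matrix.mul_assoc, hYY, Matrix.one_mul]
  have h2 : (X * Yᵀ + Y * Xᵀ) ^ 2 = X * Xᵀ + Y * (Xᵀ * X) * Yᵀ := by
    simp only [pow_two, Matrix.mul_add, Matrix.add_mul, Matrix.mul_assoc, hYXc, hXYc, hYYc,
      Matrix.mul_zero, add_zero, zero_add]
    rw [add_comm]
  have hp : (X * Yᵀ + Y * Xᵀ) ^ (2 * (k + 1)) =
      X * (Xᵀ * X) ^ k * Xᵀ + Y * (Xᵀ * X) ^ (k + 1) * Yᵀ := by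
    induction k with
    | zero => simpa using h2
    | succ k ih =>
      rw [mul_add, pow_add, ih, mul_one, h2, pow_succ (Xᵀ * X) (k + 1), pow_succ (Xᵀ * X) k]
      simp only [Matrix.mul_add, Matrix.add_mul, Matrix.mul_assoc, hYXc, hXYc, hYYc,
        Matrix.mul_zero, add_zero, zero_add]
  rw [hp, Matrix.trace_add, Matrix.mul_assoc, Matrix.trace_mul_comm, Matrix.mul_assoc,
    Matrix.mul_assoc Y, Matrix.trace_mul_comm Y, Matrix.mul_assoc, hYY, Matrix.mul_one,
    ← pow_succ]
  ring

/-- The third block of a triplet in normal form. -/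
def normalBlock (u v s w : ℝ) : Matrix (Fin 3) (Fin 3) ℝ :=
  !![0, 0, u; 0, 0, v; s, w, 0]

/-- The square of a triplet in normal form, restricted to the third coordinates. -/
def normalGram (α β₁ β₂ u v s w : ℝ) : Matrix (Fin 3) (Fin 3) ℝ :=
  !![α ^ 2 + u ^ 2 + v ^ 2, v * β₁ - u * β₂, -(α * β₁);
    v * β₁ - u * β₂, α ^ 2 + β₁ ^ 2 + β₂ ^ 2, -(α * w);
    -(α * β₁), -(α * w), s ^ 2 + w ^ 2 + β₁ ^ 2 + β₂ ^ 2]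

section BlockEntries

variable (A B C : Matrix (Fin 3) (Fin 3) ℝ)

theorem block_zero_zero : block A B C 0 0 = 0 := rfl
theorem block_zero_one : block A B C 0 1 = A := rfl
theorem block_zero_two : block A B C 0 2 = Cᵀ := rfl
theorem block_one_zero : block A B C 1 0 = Aᵀ := rfl
theorem block_one_one : block A B C 1 1 = 0 := rfl
theorem block_one_two : block A B C 1 2 = B := rfl
theorem block_two_zero : block A B C 2 0 = C := rfl
theorem block_two_one : block A B C 2 1 = Bᵀ := rfl
theorem block_two_two : block A B C 2 2 = 0 := rfl

end BlockEntries

/-- The columns of the big matrix of a triplet in normal form that belong to the third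
coordinates, split by views. -/
def normalColumns (α β₁ β₂ u v s w : ℝ) : Fin 3 → Matrix (Fin 3) (Fin 3) ℝ :=
  ![!![0, 0, s; 0, -α, w; 0, 0, 0], !![0, 0, β₂; α, 0, -β₁; 0, 0, 0],
    !![u, -β₂, 0; v, β₁, 0; 0, 0, 0]]

theorem block_normalForm_apply (α β₁ β₂ u v s w : ℝ) (i j k l : Fin 3) :
    block (crossMatrix ![α, 0, 0]) (crossMatrix ![β₁, β₂, 0]) (normalBlock u v s w) i j k l =
      (if l = 2 then normalColumns α β₁ β₂ u v s w i k j else 0) +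
        (if k = 2 then normalColumns α β₁ β₂ u v s w j l i else 0) := by
  fin_cases i <;> fin_cases j <;>
    simp only [Fin.zero_eta, Fin.mk_one, Fin.reduceFinMk, block_zero_zero, block_zero_one,
      block_zero_two, block_one_zero, block_one_one, block_one_two, block_two_zero, block_two_one,
      block_two_two] <;>
    fin_cases k <;> fin_cases l <;>
    simp [normalColumns, crossMatrix, normalBlock]

theorem transpose_mul_normalColumns (α β₁ β₂ u v s w : ℝ) :
    ∑ i, (normalColumns α β₁ β₂ u v s w i)ᵀ * normalColumns α β₁ β₂ u v s w i =
      normalGram α β₁ β₂ u v s w := by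
  rw [Fin.sum_univ_three]
  ext i j
  fin_cases i <;> fin_cases j <;>
    simp [normalColumns, normalGram, Matrix.mul_apply, Fin.sum_univ_three] <;> ring

/-- In normal form the big matrix only couples third coordinates to first and second ones. This
bipartite shape reduces 9×9 traces to traces of a 3×3 Gram matrix. -/
theorem trace_normalForm_pow (α β₁ β₂ u v s w : ℝ) (k : ℕ) :
    ((Matrix.of fun p q : Fin 3 × Fin 3 => block (crossMatrix ![α, 0, 0])
      (crossMatrix ![β₁, β₂, 0]) (normalBlock u v s w) p.1 q.1 p.2 q.2) ^ (2 * (k + 1))).trace =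
      2 * (normalGram α β₁ β₂ u v s w ^ (k + 1)).trace := by
  rw [← transpose_mul_normalColumns]
  simp only [block_normalForm_apply]
  have hrow : ∀ i j, normalColumns α β₁ β₂ u v s w i 2 j = 0 := by
    intro i j
    fin_cases i <;> fin_cases j <;> simp [normalColumns]
  generalize normalColumns α β₁ β₂ u v s w = Z at hrow ⊢
  obtain ⟨X, hX⟩ : ∃ X : Matrix (Fin 3 × Fin 3) (Fin 3) ℝ, ∀ p j, X p j = Z p.1 p.2 j :=
    ⟨fun p j => Z p.1 p.2 j, fun _ _ => rfl⟩
  obtain ⟨Y, hY⟩ : ∃ Y : Matrix (Fin 3 × Fin 3) (Fin 3) ℝ,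
      ∀ p j, Y p j = if p = (j, 2) then 1 else 0 :=
    ⟨fun p j => if p = (j, 2) then 1 else 0, fun _ _ => rfl⟩
  have hYX : Yᵀ * X = 0 := by
    ext i j
    simp [Matrix.mul_apply, hX, hY, hrow]
  have hYY : Yᵀ * Y = 1 := by
    ext i j
    simp [Matrix.mul_apply, hY, Matrix.one_apply, eq_comm]
  have hXY : ∀ p q, (X * Yᵀ) p q = if q.2 = 2 then X p q.1 else 0 := by
    rintro p ⟨j, l⟩
    simp only [Matrix.mul_apply, Matrix.transpose_apply, hY, Prod.mk.injEq]
    by_cases hl : l = 2 <;> simp [hl]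
  have hYX' : ∀ p q, (Y * Xᵀ) p q = if p.2 = 2 then X q p.1 else 0 := by
    intro p q
    rw [← hXY q p, ← Matrix.transpose_apply (X * Yᵀ), Matrix.transpose_mul,
      Matrix.transpose_transpose]
  have hN : (Matrix.of fun p q : Fin 3 × Fin 3 =>
      (if q.2 = 2 then Z p.1 p.2 q.1 else 0) + (if p.2 = 2 then Z q.1 q.2 p.1 else 0)) =
      X * Yᵀ + Y * Xᵀ := by
    ext p q
    rw [Matrix.add_apply, hXY, hYX', hX, hX, Matrix.of_apply]
  have hS : Xᵀ * X = ∑ i, (Z i)ᵀ * Z i := by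
    ext i j
    simp [Matrix.mul_apply, hX, Fintype.sum_prod_type, Matrix.sum_apply]
  rw [hN, trace_bipartite_pow X Y hYX hYY, hS]

theorem trace_symm_sq (a b c d e f : ℝ) :
    ((!![a, b, c; b, d, e; c, e, f] : Matrix (Fin 3) (Fin 3) ℝ) ^ 2).trace =
      a ^ 2 + d ^ 2 + f ^ 2 + 2 * (b ^ 2 + c ^ 2 + e ^ 2) := by
  simp [pow_two, Matrix.trace, Fin.sum_univ_three]
  ring

theorem trace_symm_cube (a b c d e f : ℝ) :
    ((!![a, b, c; b, d, e; c, e, f] : Matrix (Fin 3) (Fin 3) ℝ) ^ 3).trace =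
      a ^ 3 + d ^ 3 + f ^ 3 + 3 * (b ^ 2 * (a + d) + c ^ 2 * (a + f) + e ^ 2 * (d + f))
        + 6 * (b * c * e) := by
  simp [pow_succ, Matrix.trace, Fin.sum_univ_three]
  ring

/-- The quartic trace equation of a triplet in normal form. -/
def quarticForm (α β₁ β₂ u v s w : ℝ) : ℝ :=
  4 * (2 * α ^ 2 + 2 * (β₁ ^ 2 + β₂ ^ 2) + u ^ 2 + v ^ 2 + s ^ 2 + w ^ 2) ^ 2
    - 32 * ((α ^ 2 + u ^ 2 + v ^ 2) ^ 2 + (α ^ 2 + β₁ ^ 2 + β₂ ^ 2) ^ 2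
      + (s ^ 2 + w ^ 2 + β₁ ^ 2 + β₂ ^ 2) ^ 2
      + 2 * ((v * β₁ - u * β₂) ^ 2 + (α * β₁) ^ 2 + (α * w) ^ 2))
    + 24 * ((2 * α ^ 2) ^ 2 + (2 * (β₁ ^ 2 + β₂ ^ 2)) ^ 2
      + (u ^ 2 + v ^ 2 + s ^ 2 + w ^ 2) ^ 2)

/-- The sextic trace equation of a triplet in normal form. -/
def sexticForm (α β₁ β₂ u v s w : ℝ) : ℝ :=
  8 * (2 * α ^ 2 + 2 * (β₁ ^ 2 + β₂ ^ 2) + u ^ 2 + v ^ 2 + s ^ 2 + w ^ 2) ^ 3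
    - 48 * (2 * α ^ 2 + 2 * (β₁ ^ 2 + β₂ ^ 2) + u ^ 2 + v ^ 2 + s ^ 2 + w ^ 2)
      * ((α ^ 2 + u ^ 2 + v ^ 2) ^ 2 + (α ^ 2 + β₁ ^ 2 + β₂ ^ 2) ^ 2
      + (s ^ 2 + w ^ 2 + β₁ ^ 2 + β₂ ^ 2) ^ 2
      + 2 * ((v * β₁ - u * β₂) ^ 2 + (α * β₁) ^ 2 + (α * w) ^ 2))
    + 64 * ((α ^ 2 + u ^ 2 + v ^ 2) ^ 3 + (α ^ 2 + β₁ ^ 2 + β₂ ^ 2) ^ 3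
      + (s ^ 2 + w ^ 2 + β₁ ^ 2 + β₂ ^ 2) ^ 3
      + 3 * ((v * β₁ - u * β₂) ^ 2 * (2 * α ^ 2 + u ^ 2 + v ^ 2 + β₁ ^ 2 + β₂ ^ 2)
        + (α * β₁) ^ 2 * (α ^ 2 + u ^ 2 + v ^ 2 + s ^ 2 + w ^ 2 + β₁ ^ 2 + β₂ ^ 2)
        + (α * w) ^ 2 * (α ^ 2 + 2 * (β₁ ^ 2 + β₂ ^ 2) + s ^ 2 + w ^ 2))
      + 6 * ((v * β₁ - u * β₂) * (α * β₁) * (α * w)))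

theorem trace_normalForm_two (α β₁ β₂ u v s w : ℝ) :
    ((Matrix.of fun p q : Fin 3 × Fin 3 => block (crossMatrix ![α, 0, 0])
      (crossMatrix ![β₁, β₂, 0]) (normalBlock u v s w) p.1 q.1 p.2 q.2) ^ 2).trace =
      2 * (2 * α ^ 2 + 2 * (β₁ ^ 2 + β₂ ^ 2) + u ^ 2 + v ^ 2 + s ^ 2 + w ^ 2) := by
  have h := trace_normalForm_pow α β₁ β₂ u v s w 0
  rw [show 2 * (0 + 1) = 2 from rfl] at h
  rw [h]
  simp [normalGram, Matrix.trace, Fin.sum_univ_three]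
  ring

theorem trace_normalForm_four (α β₁ β₂ u v s w : ℝ) :
    ((Matrix.of fun p q : Fin 3 × Fin 3 => block (crossMatrix ![α, 0, 0])
      (crossMatrix ![β₁, β₂, 0]) (normalBlock u v s w) p.1 q.1 p.2 q.2) ^ 4).trace =
      2 * ((α ^ 2 + u ^ 2 + v ^ 2) ^ 2 + (α ^ 2 + β₁ ^ 2 + β₂ ^ 2) ^ 2
      + (s ^ 2 + w ^ 2 + β₁ ^ 2 + β₂ ^ 2) ^ 2
      + 2 * ((v * β₁ - u * β₂) ^ 2 + (α * β₁) ^ 2 + (α * w) ^ 2)) := by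
  have h := trace_normalForm_pow α β₁ β₂ u v s w 1
  rw [show 2 * (1 + 1) = 4 from rfl] at h
  rw [h, normalGram, trace_symm_sq]
  ring

theorem trace_normalForm_six (α β₁ β₂ u v s w : ℝ) :
    ((Matrix.of fun p q : Fin 3 × Fin 3 => block (crossMatrix ![α, 0, 0])
      (crossMatrix ![β₁, β₂, 0]) (normalBlock u v s w) p.1 q.1 p.2 q.2) ^ 6).trace =
      2 * ((α ^ 2 + u ^ 2 + v ^ 2) ^ 3 + (α ^ 2 + β₁ ^ 2 + β₂ ^ 2) ^ 3
      + (s ^ 2 + w ^ 2 + β₁ ^ 2 + β₂ ^ 2) ^ 3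
      + 3 * ((v * β₁ - u * β₂) ^ 2 * (2 * α ^ 2 + u ^ 2 + v ^ 2 + β₁ ^ 2 + β₂ ^ 2)
        + (α * β₁) ^ 2 * (α ^ 2 + u ^ 2 + v ^ 2 + s ^ 2 + w ^ 2 + β₁ ^ 2 + β₂ ^ 2)
        + (α * w) ^ 2 * (α ^ 2 + 2 * (β₁ ^ 2 + β₂ ^ 2) + s ^ 2 + w ^ 2))
      + 6 * ((v * β₁ - u * β₂) * (α * β₁) * (α * w))) := by
  have h := trace_normalForm_pow α β₁ β₂ u v s w 2
  rw [show 2 * (2 + 1) = 6 from rfl] at h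
  rw [h, normalGram, trace_symm_cube]
  ring

theorem trace_transpose_mul_eq (X : Matrix (Fin 3) (Fin 3) ℝ) :
    (Xᵀ * X).trace = X 0 0 ^ 2 + X 0 1 ^ 2 + X 0 2 ^ 2 + X 1 0 ^ 2 + X 1 1 ^ 2 + X 1 2 ^ 2
      + X 2 0 ^ 2 + X 2 1 ^ 2 + X 2 2 ^ 2 := by
  simp only [Matrix.trace, Matrix.diag_apply, Matrix.mul_apply, Matrix.transpose_apply,
    Fin.sum_univ_three]
  ring

theorem trace_mul_transpose_eq (X : Matrix (Fin 3) (Fin 3) ℝ) :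
    (X * Xᵀ).trace = X 0 0 ^ 2 + X 0 1 ^ 2 + X 0 2 ^ 2 + X 1 0 ^ 2 + X 1 1 ^ 2 + X 1 2 ^ 2
      + X 2 0 ^ 2 + X 2 1 ^ 2 + X 2 2 ^ 2 := by
  rw [Matrix.trace_mul_comm, trace_transpose_mul_eq]

theorem normalForm_quartic (α β₁ β₂ u v s w : ℝ) :
    ((Matrix.of fun p q : Fin 3 × Fin 3 => block (crossMatrix ![α, 0, 0])
      (crossMatrix ![β₁, β₂, 0]) (normalBlock u v s w) p.1 q.1 p.2 q.2) ^ 2).trace ^ 2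
      - 16 * ((Matrix.of fun p q : Fin 3 × Fin 3 => block (crossMatrix ![α, 0, 0])
      (crossMatrix ![β₁, β₂, 0]) (normalBlock u v s w) p.1 q.1 p.2 q.2) ^ 4).trace
      + 24 * (∑ i : Fin 3, ∑ j ∈ Finset.Ioi i, ((block (crossMatrix ![α, 0, 0])
      (crossMatrix ![β₁, β₂, 0]) (normalBlock u v s w) i j)ᵀ * (block (crossMatrix ![α, 0, 0])
      (crossMatrix ![β₁, β₂, 0]) (normalBlock u v s w) i j)).trace ^ 2) =
    quarticForm α β₁ β₂ u v s w := by
  have hsum : ∀ f : Fin 3 → Fin 3 → ℝ,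
      ∑ i : Fin 3, ∑ j ∈ Finset.Ioi i, f i j = f 0 1 + f 0 2 + f 1 2 := by
    intro f
    rw [Fin.sum_univ_three, show Finset.Ioi (0 : Fin 3) = {1, 2} from rfl,
      show Finset.Ioi (1 : Fin 3) = {2} from rfl, show Finset.Ioi (2 : Fin 3) = ∅ from rfl]
    simp
  rw [hsum, trace_normalForm_two, trace_normalForm_four, quarticForm, block_zero_one,
    block_zero_two, block_one_two, Matrix.transpose_transpose]
  simp only [trace_mul_transpose_eq, trace_transpose_mul_eq]
  simp [crossMatrix, normalBlock]
  ring

/-- If λ₁, λ₂, λ₃ are the eigenvalues of `normalGram` and p₁, p₂, p₃ their power sums, this quantity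
is 8(p₁³ − 6p₁p₂ + 8p₃), which is 24 times the product of the three λᵢ − λⱼ − λₖ. It vanishes when
one eigenvalue is the sum of the other two. -/
theorem normalForm_sextic (α β₁ β₂ u v s w : ℝ) :
    ((Matrix.of fun p q : Fin 3 × Fin 3 => block (crossMatrix ![α, 0, 0])
      (crossMatrix ![β₁, β₂, 0]) (normalBlock u v s w) p.1 q.1 p.2 q.2) ^ 2).trace ^ 3
      - 12 * ((Matrix.of fun p q : Fin 3 × Fin 3 => block (crossMatrix ![α, 0, 0])
      (crossMatrix ![β₁, β₂, 0]) (normalBlock u v s w) p.1 q.1 p.2 q.2) ^ 2).trace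
      * ((Matrix.of fun p q : Fin 3 × Fin 3 => block (crossMatrix ![α, 0, 0])
      (crossMatrix ![β₁, β₂, 0]) (normalBlock u v s w) p.1 q.1 p.2 q.2) ^ 4).trace
      + 32 * ((Matrix.of fun p q : Fin 3 × Fin 3 => block (crossMatrix ![α, 0, 0])
      (crossMatrix ![β₁, β₂, 0]) (normalBlock u v s w) p.1 q.1 p.2 q.2) ^ 6).trace =
    sexticForm α β₁ β₂ u v s w := by
  rw [trace_normalForm_two, trace_normalForm_four, trace_normalForm_six, sexticForm]
  ring

/-! ### Compatible triplets satisfy the equations -/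

theorem crossMatrix_planar (c₁ c₂ : ℝ) :
    crossMatrix ![c₁, c₂, 0] = normalBlock c₂ (-c₁) (-c₂) c₁ := by
  ext i j
  fin_cases i <;> fin_cases j <;> simp [crossMatrix, normalBlock]

theorem crossMatrix_adjugate (a : Fin 3 → ℝ) :
    (crossMatrix a).adjugate = Matrix.vecMulVec a a := by
  rw [Matrix.adjugate_fin_three]
  ext i j
  fin_cases i <;> fin_cases j <;> simp [crossMatrix, Matrix.vecMulVec_apply] <;> ring

/-- The first two terms give −a(a × b)ᵀ and the last gives a(a × b)ᵀ, because (−a − b) × a = a × b.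
-/
theorem crossMatrix_cubic_identity (a b : Fin 3 → ℝ) :
    (crossMatrix a)ᵀ * crossMatrix a * crossMatrix b
        - ((1 / 2 : ℝ) * ((crossMatrix a)ᵀ * crossMatrix a).trace) • crossMatrix b
        + (crossMatrix a).adjugate * (crossMatrix (-a - b))ᵀ = 0 := by
  rw [crossMatrix_adjugate, trace_transpose_mul_eq]
  ext i j
  rw [Matrix.add_apply, Matrix.sub_apply, Matrix.smul_apply, Matrix.mul_apply, Matrix.mul_apply]
  simp only [Fin.sum_univ_three, Matrix.mul_apply, Matrix.transpose_apply,
    Matrix.vecMulVec_apply]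
  fin_cases i <;> fin_cases j <;> simp [crossMatrix] <;> ring

theorem crossMatrix_diamond_identity (a b : Fin 3 → ℝ) :
    (crossMatrix b)ᵀ * (crossMatrix a).adjugate + (crossMatrix b).adjugate * (crossMatrix a)ᵀ
      + diamond (crossMatrix a * crossMatrix b) (crossMatrix (-a - b))ᵀ = 0 := by
  have h : crossMatrix a * crossMatrix b =
      Matrix.vecMulVec b a - (a 0 * b 0 + a 1 * b 1 + a 2 * b 2) • 1 := by
    ext i j
    fin_cases i <;> fin_cases j <;>
      simp [crossMatrix, Matrix.vecMulVec_apply, Fin.sum_univ_three, Matrix.mul_apply] <;> ring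
  rw [h, crossMatrix_transpose (-a - b), diamond, crossMatrix_adjugate, crossMatrix_adjugate,
    crossMatrix_adjugate, Matrix.adjugate_fin_three, Matrix.adjugate_fin_three]
  ext i j
  fin_cases i <;> fin_cases j <;>
    simp [crossMatrix, Matrix.vecMulVec_apply, Matrix.mul_apply, Fin.sum_univ_three] <;> ring

theorem compatibilityEquations_planar (α β₁ β₂ : ℝ) :
    CompatibilityEquations (block (crossMatrix ![α, 0, 0]) (crossMatrix ![β₁, β₂, 0])
      (crossMatrix ![-α - β₁, -β₂, 0])) := by
  obtain ⟨t, ht⟩ := exists_block_eq_crossMatrix_sub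
    (show ![α, 0, 0] + ![β₁, β₂, 0] + ![-α - β₁, -β₂, 0] = 0 by
      ext i
      fin_cases i <;> simp)
  refine ⟨?_, ?_, ?_, ?_, ?_⟩
  · rw [block_zero_one, block_one_two, block_two_zero]
    simp [crossMatrix, Matrix.trace, Fin.sum_univ_three]
  · intro i j k _ _ _
    rw [ht, ht, ht, show t k - t i = -(t i - t j) - (t j - t k) by abel]
    exact crossMatrix_cubic_identity _ _
  · intro i j k _ _ _
    rw [ht, ht, ht, show t k - t i = -(t i - t j) - (t j - t k) by abel]
    exact crossMatrix_diamond_identity _ _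
  · rw [crossMatrix_planar (-α - β₁), normalForm_quartic, quarticForm]
    ring
  · rw [crossMatrix_planar (-α - β₁), normalForm_sextic, sexticForm]
    ring

theorem compatibilityEquations_of_isCompatible {A B C : Matrix (Fin 3) (Fin 3) ℝ}
    (h : IsCompatible A B C) : CompatibilityEquations (block A B C) := by
  obtain ⟨R, b, hR, h⟩ := h
  -- W rotates the world so that the plane of the baselines becomes the first coordinate plane; the
  -- frames absorb its inverse.
  obtain ⟨W, hW, α, β₁, β₂, ha, hb⟩ := exists_rotation_triangular (b 0 - b 1) (b 1 - b 2)
  have hc : W *ᵥ (b 2 - b 0) = ![-α - β₁, -β₂, 0] := by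
    have e : b 2 - b 0 = -(b 0 - b 1) - (b 1 - b 2) := by abel
    rw [e, Matrix.mulVec_sub, Matrix.mulVec_neg, ha, hb]
    ext i
    fin_cases i <;> simp
  have hQ : ∀ i, R i * Wᵀ ∈ Matrix.specialOrthogonalGroup (Fin 3) ℝ := fun i =>
    mul_mem (hR i) (SO3_transpose hW)
  have key : ∀ i j, i ≠ j → block A B C i j =
      R i * Wᵀ * crossMatrix (W *ᵥ (b i - b j)) * (R j * Wᵀ)ᵀ := by
    intro i j hij
    rw [h i j hij, ← crossMatrix_conj hW]
    simp only [Matrix.transpose_mul, Matrix.transpose_transpose, mul_assoc,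
      SO3_transpose_mul_cancel hW]
  have e := (compatibilityEquations_planar α β₁ β₂).conjBlocks hQ
  rw [conjBlocks_block, ← ha, ← hb, ← hc, ← key 0 1 (by decide), ← key 1 2 (by decide),
    ← key 2 0 (by decide)] at e
  exact e

/-! ### Solving the trace equations for noncollinear baselines -/

theorem quarticForm_eq {α β₁ β₂ u v w : ℝ} (hl : β₁ * u + β₂ * v = α * β₂)
    (hm : u ^ 2 + v ^ 2 = β₂ ^ 2 + w ^ 2) :
    quarticForm α β₁ β₂ u v β₂ w =
      48 * ((u ^ 2 + v ^ 2 - (α + β₁) ^ 2 - β₂ ^ 2) * (u ^ 2 + v ^ 2 - (α - β₁) ^ 2 - β₂ ^ 2)) := by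
  -- Lagrange's identity for (β₁, β₂) and (u, v).
  have hL : (v * β₁ - u * β₂) ^ 2 = (β₁ ^ 2 + β₂ ^ 2) * (u ^ 2 + v ^ 2) - (α * β₂) ^ 2 := by
    rw [← hl]; ring
  have hw : w ^ 2 = (u ^ 2 + v ^ 2) - β₂ ^ 2 := by rw [hm]; ring
  have e : quarticForm α β₁ β₂ u v β₂ w =
      4 * (2 * α ^ 2 + 2 * (β₁ ^ 2 + β₂ ^ 2) + (u ^ 2 + v ^ 2) + β₂ ^ 2 + w ^ 2) ^ 2
      - 32 * ((α ^ 2 + (u ^ 2 + v ^ 2)) ^ 2 + (α ^ 2 + β₁ ^ 2 + β₂ ^ 2) ^ 2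
        + (β₂ ^ 2 + w ^ 2 + β₁ ^ 2 + β₂ ^ 2) ^ 2
        + 2 * ((v * β₁ - u * β₂) ^ 2 + (α * β₁) ^ 2 + α ^ 2 * w ^ 2))
      + 24 * ((2 * α ^ 2) ^ 2 + (2 * (β₁ ^ 2 + β₂ ^ 2)) ^ 2
        + ((u ^ 2 + v ^ 2) + β₂ ^ 2 + w ^ 2) ^ 2) := by
    unfold quarticForm; ring
  rw [e, hL, hw]
  ring

theorem sexticForm_eq {α β₁ β₂ u v w : ℝ} (hl : β₁ * u + β₂ * v = α * β₂)
    (hm : u ^ 2 + v ^ 2 = β₂ ^ 2 + w ^ 2) (hK : u ^ 2 + v ^ 2 = (α + β₁) ^ 2 + β₂ ^ 2) :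
    sexticForm α β₁ β₂ u v β₂ w =
      384 * (α ^ 2 * β₁ * ((v * β₁ - u * β₂) * w
        + (α + β₁) * (β₁ ^ 2 + β₂ ^ 2 + α * β₁))) := by
  have hL : (v * β₁ - u * β₂) ^ 2 = (β₁ ^ 2 + β₂ ^ 2 + α * β₁) ^ 2 := by
    linear_combination (β₁ ^ 2 + β₂ ^ 2) * hK - (β₁ * u + β₂ * v + α * β₂) * hl
  have hw : w ^ 2 = (α + β₁) ^ 2 := by linear_combination hK - hm
  have e : sexticForm α β₁ β₂ u v β₂ w =
      8 * (2 * α ^ 2 + 2 * (β₁ ^ 2 + β₂ ^ 2) + (u ^ 2 + v ^ 2) + β₂ ^ 2 + w ^ 2) ^ 3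
      - 48 * (2 * α ^ 2 + 2 * (β₁ ^ 2 + β₂ ^ 2) + (u ^ 2 + v ^ 2) + β₂ ^ 2 + w ^ 2)
        * ((α ^ 2 + (u ^ 2 + v ^ 2)) ^ 2 + (α ^ 2 + β₁ ^ 2 + β₂ ^ 2) ^ 2
        + (β₂ ^ 2 + w ^ 2 + β₁ ^ 2 + β₂ ^ 2) ^ 2
        + 2 * ((v * β₁ - u * β₂) ^ 2 + (α * β₁) ^ 2 + α ^ 2 * w ^ 2))
      + 64 * ((α ^ 2 + (u ^ 2 + v ^ 2)) ^ 3 + (α ^ 2 + β₁ ^ 2 + β₂ ^ 2) ^ 3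
        + (β₂ ^ 2 + w ^ 2 + β₁ ^ 2 + β₂ ^ 2) ^ 3
        + 3 * ((v * β₁ - u * β₂) ^ 2 * (2 * α ^ 2 + (u ^ 2 + v ^ 2) + β₁ ^ 2 + β₂ ^ 2)
          + (α * β₁) ^ 2 * (α ^ 2 + (u ^ 2 + v ^ 2) + β₂ ^ 2 + w ^ 2 + β₁ ^ 2 + β₂ ^ 2)
          + α ^ 2 * w ^ 2 * (α ^ 2 + 2 * (β₁ ^ 2 + β₂ ^ 2) + β₂ ^ 2 + w ^ 2)))
      + 384 * (α ^ 2 * β₁ * ((v * β₁ - u * β₂) * w)) := by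
    unfold sexticForm; ring
  rw [e, hL, hw, hK]
  ring

/-- The parameters of the third block for which a triplet in normal form is compatible without a
reflection of the first frame. -/
def IsNormalSolution (α β₁ β₂ u v w : ℝ) : Prop :=
  (v * β₁ - u * β₂ = β₁ ^ 2 + β₂ ^ 2 + α * β₁ ∧ w = -(α + β₁)) ∨
    (v * β₁ - u * β₂ = -(β₁ ^ 2 + β₂ ^ 2 + α * β₁) ∧ w = α + β₁)

theorem isNormalSolution_or {α β₁ β₂ u v w : ℝ} (hα : α ≠ 0)
    (hl : β₁ * u + β₂ * v = α * β₂) (hm : u ^ 2 + v ^ 2 = β₂ ^ 2 + w ^ 2)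
    (hK : u ^ 2 + v ^ 2 = (α + β₁) ^ 2 + β₂ ^ 2) (h6 : sexticForm α β₁ β₂ u v β₂ w = 0) :
    IsNormalSolution α β₁ β₂ u v w ∨ IsNormalSolution (-α) β₁ β₂ (-u) (-v) (-w) := by
  have hL : (v * β₁ - u * β₂) ^ 2 = (β₁ ^ 2 + β₂ ^ 2 + α * β₁) ^ 2 := by
    linear_combination (β₁ ^ 2 + β₂ ^ 2) * hK - (β₁ * u + β₂ * v + α * β₂) * hl
  have hw : w ^ 2 = (α + β₁) ^ 2 := by linear_combination hK - hm
  rw [sexticForm_eq hl hm hK] at h6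
  have hneg : -v * β₁ - -u * β₂ = -(v * β₁ - u * β₂) := by ring
  unfold IsNormalSolution
  rw [hneg]
  generalize v * β₁ - u * β₂ = l at *
  generalize hQ : β₁ ^ 2 + β₂ ^ 2 = q at *
  rcases eq_or_ne β₁ 0 with h0 | h0
  -- Here the sextic equation is void, but the four sign patterns are shared out between α and −α.
  · subst h0
    simp only [add_zero, mul_zero] at *
    rcases sq_eq_sq_iff_eq_or_eq_neg.1 hL with h | h <;>
      rcases sq_eq_sq_iff_eq_or_eq_neg.1 hw with h' | h' <;> simp [h, h']
  · left
    have hp : l * w = -((α + β₁) * (q + α * β₁)) := by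
      have h := mul_ne_zero (pow_ne_zero 2 hα) h0
      rw [mul_eq_zero, mul_eq_zero] at h6
      rcases h6 with h6 | h6 | h6
      · norm_num at h6
      · exact absurd h6 h
      · linear_combination h6
    rcases sq_eq_sq_iff_eq_or_eq_neg.1 hL with h | h
    -- If this vanishes then l = 0, so either sign of l may be paired with the sign of w.
    · rcases eq_or_ne (q + α * β₁) 0 with hz | hz
      · rw [h, hz]
        rcases sq_eq_sq_iff_eq_or_eq_neg.1 hw with h' | h' <;> simp [h']
      · refine Or.inl ⟨h, mul_left_cancel₀ hz ?_⟩
        rw [h] at hp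
        linear_combination hp
    · rcases eq_or_ne (q + α * β₁) 0 with hz | hz
      · rw [h, hz]
        rcases sq_eq_sq_iff_eq_or_eq_neg.1 hw with h' | h' <;> simp [h']
      · refine Or.inr ⟨h, mul_left_cancel₀ hz ?_⟩
        rw [h] at hp
        linear_combination -hp

theorem half_turn_mem :
    !![1, 0, 0; 0, -1, 0; 0, 0, -1] ∈ Matrix.specialOrthogonalGroup (Fin 3) ℝ := by
  simpa using rotation12_mem (c := -1) (s := 0) (by norm_num)

theorem half_turn_mul_crossMatrix (t : ℝ) :
    !![1, 0, 0; 0, -1, 0; 0, 0, -1] * crossMatrix ![t, 0, 0] = crossMatrix ![-t, 0, 0] := by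
  ext i j
  fin_cases i <;> fin_cases j <;> simp [crossMatrix, Matrix.mul_apply, Fin.sum_univ_three]

theorem crossMatrix_mul_half_turn (t : ℝ) :
    crossMatrix ![t, 0, 0] * !![1, 0, 0; 0, -1, 0; 0, 0, -1]ᵀ = crossMatrix ![-t, 0, 0] := by
  ext i j
  fin_cases i <;> fin_cases j <;> simp [crossMatrix, Matrix.mul_apply, Fin.sum_univ_three]

theorem normalBlock_mul_half_turn (u v s w : ℝ) :
    normalBlock u v s w * !![1, 0, 0; 0, -1, 0; 0, 0, -1]ᵀ = normalBlock (-u) (-v) s (-w) := by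
  ext i j
  fin_cases i <;> fin_cases j <;> simp [normalBlock, Matrix.mul_apply, Fin.sum_univ_three]

theorem isCompatible_crossMatrix {a b c : Fin 3 → ℝ} (h : a + b + c = 0) :
    IsCompatible (crossMatrix a) (crossMatrix b) (crossMatrix c) := by
  simpa using isCompatible_of_add_eq_zero (R := fun _ => 1) (fun _ => one_mem _) h

theorem planar_half_turn_mem {c s : ℝ} (h : c ^ 2 + s ^ 2 = 1) :
    !![c, s, 0; s, -c, 0; 0, 0, -1] ∈ Matrix.specialOrthogonalGroup (Fin 3) ℝ := by
  rw [mem_SO3_iff]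
  constructor
  · ext i j
    fin_cases i <;> fin_cases j <;> simp [Matrix.mul_apply, Fin.sum_univ_three] <;>
      first | linear_combination h | ring
  · simp [Matrix.det_fin_three]
    linear_combination h

/-- The linear relation fixes the component of (u, v) along (β₁, β₂), and the sign in
`IsNormalSolution` fixes the transverse one. One sign gives [−a − b]ₓ; the other gives its image
under half turns about a and b. -/
theorem IsNormalSolution.isCompatible {α β₁ β₂ u v w : ℝ}
    (h : IsNormalSolution α β₁ β₂ u v w) (hβ : β₂ ≠ 0) (hl : β₁ * u + β₂ * v = α * β₂) :
    IsCompatible (crossMatrix ![α, 0, 0]) (crossMatrix ![β₁, β₂, 0])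
      (normalBlock u v β₂ w) := by
  have hq : β₁ ^ 2 + β₂ ^ 2 ≠ 0 := by positivity
  rcases h with ⟨h, rfl⟩ | ⟨h, rfl⟩
  · have hu : u = -β₂ := mul_left_cancel₀ hq (by linear_combination β₁ * hl - β₂ * h)
    have hv : v = α + β₁ := mul_left_cancel₀ hq (by linear_combination β₂ * hl + β₁ * h)
    have e : normalBlock u v β₂ (-(α + β₁)) = crossMatrix ![-(α + β₁), -β₂, 0] := by
      rw [crossMatrix_planar, hu, hv, neg_neg, neg_neg]
    rw [e]
    refine isCompatible_crossMatrix ?_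
    ext i
    fin_cases i <;> simp
  -- These are the cosine and sine of twice the polar angle of (β₁, β₂), so the matrix built from
  -- them is the half turn about b.
  · obtain ⟨c, hc⟩ : ∃ c, c = (β₁ ^ 2 - β₂ ^ 2) / (β₁ ^ 2 + β₂ ^ 2) := ⟨_, rfl⟩
    obtain ⟨s, hs⟩ : ∃ s, s = 2 * β₁ * β₂ / (β₁ ^ 2 + β₂ ^ 2) := ⟨_, rfl⟩
    rw [eq_div_iff hq] at hc hs
    have hcs : c ^ 2 + s ^ 2 = 1 := by
      refine mul_left_cancel₀ (pow_ne_zero 2 hq) ?_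
      linear_combination (c * (β₁ ^ 2 + β₂ ^ 2) + β₁ ^ 2 - β₂ ^ 2) * hc
        + (s * (β₁ ^ 2 + β₂ ^ 2) + 2 * β₁ * β₂) * hs
    have h1 : β₂ * c - β₁ * s = -β₂ :=
      mul_left_cancel₀ hq (by linear_combination β₂ * hc - β₁ * hs)
    have h2 : β₂ * s + β₁ * c = β₁ :=
      mul_left_cancel₀ hq (by linear_combination β₂ * hs + β₁ * hc)
    have hu : u = -(c * β₂) + s * (α + β₁) := by
      refine mul_left_cancel₀ hq ?_
      linear_combination β₁ * hl - β₂ * h + β₂ * hc - (α + β₁) * hs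
    have hv : v = -(s * β₂) - c * (α + β₁) := by
      refine mul_left_cancel₀ hq ?_
      linear_combination β₂ * hl + β₁ * h + β₂ * hs + (α + β₁) * hc
    -- All baselines are negated; the half turns about a and b in the first and third views restore
    -- the first two blocks.
    have key := isCompatible_of_add_eq_zero
      (R := ![!![1, 0, 0; 0, -1, 0; 0, 0, -1], 1, !![c, s, 0; s, -c, 0; 0, 0, -1]])
      (a := ![-α, 0, 0]) (b := ![-β₁, -β₂, 0]) (c := ![α + β₁, β₂, 0])
      (by
        intro i
        fin_cases i
        · exact half_turn_mem
        · exact one_mem _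
        · exact planar_half_turn_mem hcs)
      (by
        ext i
        fin_cases i <;> simp
        ring)
    have e1 : !![1, 0, 0; 0, -1, 0; 0, 0, -1] * crossMatrix ![-α, 0, 0] *
        (1 : Matrix (Fin 3) (Fin 3) ℝ)ᵀ = crossMatrix ![α, 0, 0] := by
      rw [half_turn_mul_crossMatrix, neg_neg, Matrix.transpose_one, mul_one]
    have e2 : (1 : Matrix (Fin 3) (Fin 3) ℝ) * crossMatrix ![-β₁, -β₂, 0] *
        !![c, s, 0; s, -c, 0; 0, 0, -1]ᵀ = crossMatrix ![β₁, β₂, 0] := by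
      rw [one_mul]
      ext i j
      fin_cases i <;> fin_cases j <;>
        simp [crossMatrix, Matrix.mul_apply, Fin.sum_univ_three]
      · linear_combination h1
      · linear_combination h2
    have e3 : !![c, s, 0; s, -c, 0; 0, 0, -1] * crossMatrix ![α + β₁, β₂, 0] *
        !![1, 0, 0; 0, -1, 0; 0, 0, -1]ᵀ = normalBlock u v β₂ (α + β₁) := by
      rw [hu, hv]
      ext i j
      fin_cases i <;> fin_cases j <;>
        simp [crossMatrix, normalBlock, Matrix.mul_apply, Fin.sum_univ_three] <;> ring
    rw [← e1, ← e2, ← e3]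
    exact key

theorem isCompatible_normalForm {α β₁ β₂ u v w : ℝ} (hα : α ≠ 0) (hβ : β₂ ≠ 0)
    (hl : β₁ * u + β₂ * v = α * β₂) (hm : u ^ 2 + v ^ 2 = β₂ ^ 2 + w ^ 2)
    (h4 : quarticForm α β₁ β₂ u v β₂ w = 0) (h6 : sexticForm α β₁ β₂ u v β₂ w = 0) :
    IsCompatible (crossMatrix ![α, 0, 0]) (crossMatrix ![β₁, β₂, 0])
      (normalBlock u v β₂ w) := by
  have hl' : β₁ * -u + β₂ * -v = -α * β₂ := by linear_combination -hl
  have hflip : IsNormalSolution (-α) β₁ β₂ (-u) (-v) (-w) →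
      IsCompatible (crossMatrix ![α, 0, 0]) (crossMatrix ![β₁, β₂, 0])
        (normalBlock u v β₂ w) := by
    intro h
    refine isCompatible_of_conj (Q := ![!![1, 0, 0; 0, -1, 0; 0, 0, -1], 1, 1]) ?_ ?_
    · intro i
      fin_cases i
      · exact half_turn_mem
      · exact one_mem _
      · exact one_mem _
    · have := h.isCompatible hβ hl'
      rw [← half_turn_mul_crossMatrix, ← normalBlock_mul_half_turn] at this
      simpa using this
  have hsol : IsNormalSolution α β₁ β₂ u v w ∨ IsNormalSolution (-α) β₁ β₂ (-u) (-v) (-w) := by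
    rw [quarticForm_eq hl hm, mul_eq_zero, mul_eq_zero] at h4
    rcases h4 with h4 | h4 | h4
    · norm_num at h4
    · exact isNormalSolution_or hα hl hm (by linear_combination h4) h6
    -- The second factor is the first with α negated, the case reached by a half turn of the first
    -- view.
    · have h6' : sexticForm (-α) β₁ β₂ (-u) (-v) β₂ (-w) = 0 := by
        rw [← h6]; unfold sexticForm; ring
      have := isNormalSolution_or (neg_ne_zero.2 hα) hl' (by linear_combination hm)
        (by linear_combination h4) h6'
      simpa only [neg_neg, or_comm] using this
  rcases hsol with h | h
  · exact h.isCompatible hβ hl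
  · exact hflip h

/-! ### Collinear baselines in normal form -/

theorem isCompatible_collinear {α β γ : ℝ} (h4 : quarticForm α β 0 0 (-γ) 0 γ = 0) :
    IsCompatible (crossMatrix ![α, 0, 0]) (crossMatrix ![β, 0, 0]) (crossMatrix ![γ, 0, 0]) := by
  have hsum : ∀ {x y z : ℝ}, x + y + z = 0 →
      IsCompatible (crossMatrix ![x, 0, 0]) (crossMatrix ![y, 0, 0]) (crossMatrix ![z, 0, 0]) := by
    intro x y z h
    refine isCompatible_crossMatrix ?_
    ext i
    fin_cases i <;> simp [h]
  -- A Heron-type factorization. A half turn of one view negates exactly the two blocks meeting it,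
  -- which turns each other factor into a closed triangle.
  have hfac : (α + β + γ) * ((-α + β + -γ) * ((-α + -β + γ) * (α + -β + -γ))) = 0 := by
    unfold quarticForm at h4
    linear_combination (1 / 48 : ℝ) * h4
  rcases mul_eq_zero.1 hfac with h | h
  · exact hsum h
  rcases mul_eq_zero.1 h with h | h
  · refine isCompatible_of_conj (Q := ![!![1, 0, 0; 0, -1, 0; 0, 0, -1], 1, 1]) ?_ ?_
    · intro i
      fin_cases i
      exacts [half_turn_mem, one_mem _, one_mem _]
    · have := hsum h
      rw [← half_turn_mul_crossMatrix α, ← crossMatrix_mul_half_turn γ] at this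
      simpa using this
  rcases mul_eq_zero.1 h with h | h
  · refine isCompatible_of_conj (Q := ![1, !![1, 0, 0; 0, -1, 0; 0, 0, -1], 1]) ?_ ?_
    · intro i
      fin_cases i
      exacts [one_mem _, half_turn_mem, one_mem _]
    · have := hsum h
      rw [← crossMatrix_mul_half_turn α, ← half_turn_mul_crossMatrix β] at this
      simpa using this
  · refine isCompatible_of_conj (Q := ![1, 1, !![1, 0, 0; 0, -1, 0; 0, 0, -1]]) ?_ ?_
    · intro i
      fin_cases i
      exacts [one_mem _, one_mem _, half_turn_mem]
    · have := hsum h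
      rw [← crossMatrix_mul_half_turn β, ← half_turn_mul_crossMatrix γ] at this
      simpa using this

/-! ### Epipoles and the cubic equations -/

theorem SO3_dotProduct_mulVec {W : Matrix (Fin 3) (Fin 3) ℝ}
    (hW : W ∈ Matrix.specialOrthogonalGroup (Fin 3) ℝ) (v : Fin 3 → ℝ) :
    (W *ᵥ v) ⬝ᵥ (W *ᵥ v) = v ⬝ᵥ v := by
  rw [Matrix.dotProduct_mulVec, ← Matrix.mulVec_transpose, Matrix.mulVec_mulVec,
    SO3_transpose_mul hW, Matrix.one_mulVec]

theorem SO3_mulVec_ne_zero {W : Matrix (Fin 3) (Fin 3) ℝ}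
    (hW : W ∈ Matrix.specialOrthogonalGroup (Fin 3) ℝ) {v : Fin 3 → ℝ} (hv : v ≠ 0) :
    W *ᵥ v ≠ 0 := by
  intro h
  apply hv
  rw [← Matrix.one_mulVec v, ← SO3_transpose_mul hW, ← Matrix.mulVec_mulVec, h,
    Matrix.mulVec_zero]

theorem crossMatrix_transpose_mul_self (c : Fin 3 → ℝ) :
    (crossMatrix c)ᵀ * crossMatrix c = (c ⬝ᵥ c) • 1 - Matrix.vecMulVec c c := by
  ext i j
  fin_cases i <;> fin_cases j <;>
    simp [crossMatrix, Matrix.mul_apply, Matrix.vecMulVec_apply, dotProduct,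
      Fin.sum_univ_three] <;> ring

/-- The epipoles `x`, `y` of a nonzero essential matrix and their common squared length `κ`. -/
theorem exists_epipoles {P S : Matrix (Fin 3) (Fin 3) ℝ}
    (hP : P ∈ Matrix.specialOrthogonalGroup (Fin 3) ℝ)
    (hS : S ∈ Matrix.specialOrthogonalGroup (Fin 3) ℝ) {c : Fin 3 → ℝ} (hc : c ≠ 0) :
    ∃ (x y : Fin 3 → ℝ) (κ : ℝ), κ ≠ 0 ∧ y ⬝ᵥ y = κ ∧
      (P * crossMatrix c * Sᵀ) *ᵥ y = 0 ∧
      (P * crossMatrix c * Sᵀ)ᵀ * (P * crossMatrix c * Sᵀ) = κ • 1 - Matrix.vecMulVec y y ∧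
      (P * crossMatrix c * Sᵀ).adjugate = Matrix.vecMulVec y x := by
  refine ⟨P *ᵥ c, S *ᵥ c, c ⬝ᵥ c, ?_, SO3_dotProduct_mulVec hS c, ?_, ?_, ?_⟩
  · exact fun h => hc (dotProduct_self_eq_zero.1 h)
  · rw [Matrix.mulVec_mulVec, mul_assoc, SO3_transpose_mul hS, mul_one, ← Matrix.mulVec_mulVec,
      crossMatrix_mulVec, cross_self, Matrix.mulVec_zero]
  · have e : (P * crossMatrix c * Sᵀ)ᵀ * (P * crossMatrix c * Sᵀ) =
        S * ((crossMatrix c)ᵀ * crossMatrix c) * Sᵀ := by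
      simp only [Matrix.transpose_mul, Matrix.transpose_transpose, mul_assoc,
        SO3_transpose_mul_cancel hP]
    rw [e, crossMatrix_transpose_mul_self, mul_sub, sub_mul, Matrix.mul_smul, Matrix.smul_mul,
      mul_one, SO3_mul_transpose hS, Matrix.mul_vecMulVec, Matrix.vecMulVec_mul,
      Matrix.vecMul_transpose]
  · rw [SO3_adjugate_conj hP hS, crossMatrix_adjugate, Matrix.mul_vecMulVec,
      Matrix.vecMulVec_mul, Matrix.vecMul_transpose]

theorem crossMatrix_gram_sub_half_trace (a : Fin 3 → ℝ) (X : Matrix (Fin 3) (Fin 3) ℝ) :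
    (crossMatrix a)ᵀ * crossMatrix a * X
      - ((1 / 2 : ℝ) * ((crossMatrix a)ᵀ * crossMatrix a).trace) • X =
      -Matrix.vecMulVec a (a ᵥ* X) := by
  have h : (1 / 2 : ℝ) * ((crossMatrix a)ᵀ * crossMatrix a).trace = a ⬝ᵥ a := by
    rw [crossMatrix_transpose_mul_self]
    simp [Matrix.trace_sub, Matrix.trace_smul, Matrix.trace_vecMulVec]
    ring
  rw [h, crossMatrix_transpose_mul_self, sub_mul, Matrix.smul_mul, one_mul,
    Matrix.vecMulVec_mul]
  abel

/-- Both terms of the equation have the form of a column a times a row, so the nonzero a cancels. -/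
theorem vecMul_eq_of_cubic_equation {a : Fin 3 → ℝ} (ha : a ≠ 0)
    {X Y : Matrix (Fin 3) (Fin 3) ℝ}
    (h : (crossMatrix a)ᵀ * crossMatrix a * X
      - ((1 / 2 : ℝ) * ((crossMatrix a)ᵀ * crossMatrix a).trace) • X
      + (crossMatrix a).adjugate * Yᵀ = 0) :
    a ᵥ* X = Y *ᵥ a := by
  rw [crossMatrix_gram_sub_half_trace, crossMatrix_adjugate, Matrix.vecMulVec_mul,
    Matrix.vecMul_transpose] at h
  obtain ⟨i, hi⟩ := Function.ne_iff.1 ha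
  funext j
  have := congrFun (congrFun h i) j
  simp only [Matrix.add_apply, Matrix.neg_apply, Matrix.vecMulVec_apply, Matrix.zero_apply] at this
  exact mul_left_cancel₀ hi (by linear_combination -this)

theorem vecMul_eq_of_cubic_equation' {x y : Fin 3 → ℝ} {κ : ℝ} (hκ : κ ≠ 0) (hy : y ⬝ᵥ y = κ)
    {X Y Z : Matrix (Fin 3) (Fin 3) ℝ} (hZ : Zᵀ * Z = κ • 1 - Matrix.vecMulVec y y)
    (hadj : Z.adjugate = Matrix.vecMulVec y x)
    (h : Zᵀ * Z * X - ((1 / 2 : ℝ) * (Zᵀ * Z).trace) • X + Z.adjugate * Yᵀ = 0) :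
    y ᵥ* X = Y *ᵥ x := by
  have ht : (1 / 2 : ℝ) * (Zᵀ * Z).trace = κ := by
    rw [hZ]
    simp [Matrix.trace_sub, Matrix.trace_smul, Matrix.trace_vecMulVec, hy]
    ring
  rw [ht, hZ, hadj, sub_mul, Matrix.smul_mul, one_mul, Matrix.vecMulVec_mul,
    Matrix.vecMulVec_mul, Matrix.vecMul_transpose] at h
  have hy0 : y ≠ 0 := by
    rintro rfl
    exact hκ (by simpa using hy.symm)
  obtain ⟨i, hi⟩ := Function.ne_iff.1 hy0
  funext j
  have := congrFun (congrFun h i) j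
  simp only [Matrix.add_apply, Matrix.sub_apply, Matrix.vecMulVec_apply,
    Matrix.zero_apply] at this
  exact mul_left_cancel₀ hi (by linear_combination -this)

/-! ### Diagonal entries of a planar reflection -/

/-- Conjugation by a rotation turns a traceless symmetric 2×2 matrix through twice the angle, so a
half angle is needed to clear its diagonal. The direction C = −1 is separate because the half-angle
formula would divide by c = 0. -/
theorem exists_half_angle (x y : ℝ) :
    ∃ c s : ℝ, c ^ 2 + s ^ 2 = 1 ∧ (c ^ 2 - s ^ 2) * x + 2 * (c * s) * y = 0 := by
  obtain ⟨C, S, h, e⟩ := exists_givens (-y) x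
  rcases eq_or_ne C (-1) with rfl | hC
  · have hS : S = 0 := by simpa using h
    subst hS
    exact ⟨0, 1, by norm_num, by linear_combination e⟩
  · have hC1 : 0 < 1 + C := by
      rcases lt_trichotomy (1 + C) 0 with h' | h' | h'
      · nlinarith [sq_nonneg S]
      · exact absurd (by linarith) hC
      · exact h'
    obtain ⟨c, hc0, hc⟩ : ∃ c : ℝ, c ≠ 0 ∧ c ^ 2 = (1 + C) / 2 :=
      ⟨√((1 + C) / 2), (Real.sqrt_pos.2 (by linarith)).ne', Real.sq_sqrt (by linarith)⟩
    obtain ⟨s, hs⟩ : ∃ s, s = S / (2 * c) := ⟨_, rfl⟩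
    rw [eq_div_iff (by simpa using hc0)] at hs
    have hs2 : s ^ 2 = (1 - C) / 2 := by
      refine mul_left_cancel₀ (pow_ne_zero 2 hc0) ?_
      linear_combination (1 / 4) * (2 * s * c + S) * hs + (1 / 4) * h - (1 - C) / 2 * hc
    exact ⟨c, s, by linear_combination hc + hs2, by
      linear_combination x * hc - x * hs2 + y * hs + e⟩

theorem rotation12_conj_reflection {p s x y : ℝ}
    (e : (p ^ 2 - s ^ 2) * x + 2 * (p * s) * y = 0) :
    !![1, 0, 0; 0, p, s; 0, -s, p] * !![0, 0, 0; 0, x, y; 0, y, -x] *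
        !![1, 0, 0; 0, p, s; 0, -s, p]ᵀ =
      normalBlock 0 ((p ^ 2 - s ^ 2) * y - 2 * (p * s) * x) 0
        ((p ^ 2 - s ^ 2) * y - 2 * (p * s) * x) := by
  ext i j
  fin_cases i <;> fin_cases j <;>
    simp [normalBlock, Matrix.mul_apply, Fin.sum_univ_three]
  · linear_combination e
  · ring
  · ring
  · linear_combination -e

/-! ### Forcing the third block into normal form -/

theorem isCompatible_of_planar_baseline {α β₁ β₂ : ℝ} (hα : α ≠ 0) (hβ : β₂ ≠ 0)
    {P S : Matrix (Fin 3) (Fin 3) ℝ} (hP : P ∈ Matrix.specialOrthogonalGroup (Fin 3) ℝ)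
    (hS : S ∈ Matrix.specialOrthogonalGroup (Fin 3) ℝ) {c : Fin 3 → ℝ} (hc : c ≠ 0)
    (h : CompatibilityEquations (block (crossMatrix ![α, 0, 0]) (crossMatrix ![β₁, β₂, 0])
      (P * crossMatrix c * Sᵀ))) :
    IsCompatible (crossMatrix ![α, 0, 0]) (crossMatrix ![β₁, β₂, 0])
      (P * crossMatrix c * Sᵀ) := by
  obtain ⟨x, y, κ, hκ, hyy, hCy, hCC, hadj⟩ := exists_epipoles hP hS hc
  generalize P * crossMatrix c * Sᵀ = C at *
  have ha : (![α, 0, 0] : Fin 3 → ℝ) ≠ 0 := fun e => hα (by simpa using congrFun e 0)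
  have hb : (![β₁, β₂, 0] : Fin 3 → ℝ) ≠ 0 := fun e => hβ (by simpa using congrFun e 1)
  have k1 := vecMul_eq_of_cubic_equation ha (h.2.1 0 1 2 (by decide) (by decide) (by decide))
  have k2 := vecMul_eq_of_cubic_equation hb (h.2.1 1 2 0 (by decide) (by decide) (by decide))
  have k3 := vecMul_eq_of_cubic_equation' hκ hyy hCC hadj
    (h.2.1 2 0 1 (by decide) (by decide) (by decide))
  rw [block_one_two, block_two_zero] at k1
  rw [block_two_zero, block_zero_one] at k2
  rw [block_zero_one, block_one_two] at k3
  have a0 := congrFun k1 0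
  have a1 := congrFun k1 1
  have a2 := congrFun k1 2
  have b1 := congrFun k2 1
  have b2 := congrFun k2 2
  have d0 := congrFun k3 0
  have d1 := congrFun k3 1
  have y0 := congrFun hCy 0
  have y1 := congrFun hCy 1
  have y2 := congrFun hCy 2
  have g00 := congrFun (congrFun hCC 0) 0
  have g02 := congrFun (congrFun hCC 0) 2
  have g11 := congrFun (congrFun hCC 1) 1
  have g22 := congrFun (congrFun hCC 2) 2
  simp [crossMatrix, Matrix.vecMul, Matrix.mulVec, dotProduct, Fin.sum_univ_three,
    Matrix.mul_apply, Matrix.vecMulVec_apply] at a0 a1 a2 b1 b2 d0 d1 y0 y1 y2 g00 g02 g11 g22 hyy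
  simp only [hα, hβ, or_false, false_or] at a0 a1 d0
  -- The first column of C is the first row of [b]ₓ.
  have hC20 : C 2 0 = β₂ := mul_right_cancel₀ hα (by rw [← a2, mul_comm])
  -- The relation yᵀ[a]ₓ = ([b]ₓx)ᵀ puts both epipoles of C in the plane of a and b.
  have hy2 : y 2 = 0 := by simpa [d0, hα] using d1
  rw [a0, hy2] at y0
  rw [a1, hy2] at y1
  rw [hC20, hy2] at y2
  have hy1 : y 1 ≠ 0 := by
    intro h1
    have h0 : y 0 = 0 := by simpa [h1, hβ] using y2
    exact hκ (by rw [← hyy, h0, h1, hy2]; ring)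
  have hC01 : C 0 1 = 0 := by simpa [hy1] using y0
  have hC11 : C 1 1 = 0 := by simpa [hy1] using y1
  have hC22 : C 2 2 = 0 := by simpa [a0, a1, hC20, hy2, hβ] using g02
  have hC : C = normalBlock (C 0 2) (C 1 2) β₂ (C 2 1) := by
    ext i j
    fin_cases i <;> fin_cases j <;> simp [normalBlock, a0, a1, hC20, hC01, hC11, hC22]
  -- Column j of C has squared length κ − yⱼ², and y₀² + y₁² = κ.
  have hm : C 0 2 ^ 2 + C 1 2 ^ 2 = β₂ ^ 2 + C 2 1 ^ 2 := by
    rw [a0, a1, hC20] at g00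
    rw [hC01, hC11] at g11
    rw [hC22, hy2] at g22
    rw [hy2] at hyy
    linear_combination g22 - g00 - g11 + hyy
  obtain ⟨-, -, -, h4, h6⟩ := h
  rw [hC] at h4 h6 ⊢
  rw [normalForm_quartic] at h4
  rw [normalForm_sextic] at h6
  exact isCompatible_normalForm hα hβ b2 hm h4 h6

theorem isCompatible_of_collinear_baseline {α β : ℝ} (hα : α ≠ 0) (hβ : β ≠ 0)
    {P S : Matrix (Fin 3) (Fin 3) ℝ} (hP : P ∈ Matrix.specialOrthogonalGroup (Fin 3) ℝ)
    (hS : S ∈ Matrix.specialOrthogonalGroup (Fin 3) ℝ) {c : Fin 3 → ℝ} (hc : c ≠ 0)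
    (h : CompatibilityEquations (block (crossMatrix ![α, 0, 0]) (crossMatrix ![β, 0, 0])
      (P * crossMatrix c * Sᵀ))) :
    IsCompatible (crossMatrix ![α, 0, 0]) (crossMatrix ![β, 0, 0])
      (P * crossMatrix c * Sᵀ) := by
  obtain ⟨x, y, κ, hκ, hyy, -, hCC, -⟩ := exists_epipoles hP hS hc
  generalize P * crossMatrix c * Sᵀ = C at *
  have ha : (![α, 0, 0] : Fin 3 → ℝ) ≠ 0 := fun e => hα (by simpa using congrFun e 0)
  have hb : (![β, 0, 0] : Fin 3 → ℝ) ≠ 0 := fun e => hβ (by simpa using congrFun e 0)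
  have k1 := vecMul_eq_of_cubic_equation ha (h.2.1 0 1 2 (by decide) (by decide) (by decide))
  have k2 := vecMul_eq_of_cubic_equation hb (h.2.1 1 2 0 (by decide) (by decide) (by decide))
  have ht := h.1
  rw [block_one_two, block_two_zero] at k1
  rw [block_two_zero, block_zero_one] at k2
  rw [block_zero_one, block_one_two, block_two_zero] at ht
  have a0 := congrFun k1 0
  have a1 := congrFun k1 1
  have a2 := congrFun k1 2
  have b1 := congrFun k2 1
  have b2 := congrFun k2 2
  have g00 := congrFun (congrFun hCC 0) 0
  have g11 := congrFun (congrFun hCC 1) 1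
  have g12 := congrFun (congrFun hCC 1) 2
  have g22 := congrFun (congrFun hCC 2) 2
  simp [crossMatrix, Matrix.vecMul, Matrix.mulVec, dotProduct, Fin.sum_univ_three,
    Matrix.mul_apply, Matrix.vecMulVec_apply, Matrix.trace, hα, hβ]
    at a0 a1 a2 b1 b2 g00 g11 g12 g22 hyy ht
  have hy12 : y 1 * y 1 + y 2 * y 2 = 0 := by
    rw [a0, a1, a2] at g00
    linear_combination hyy - g00
  have hy1 : y 1 = 0 := by nlinarith [mul_self_nonneg (y 1), mul_self_nonneg (y 2)]
  have hy2 : y 2 = 0 := by nlinarith [mul_self_nonneg (y 1), mul_self_nonneg (y 2)]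
  rw [b1, hy1] at g11
  rw [b2, hy2] at g22
  rw [b1, b2, hy1] at g12
  have ht' : C 2 2 = -C 1 1 := by
    refine mul_left_cancel₀ (mul_ne_zero hα hβ) ?_
    linear_combination -ht
  rw [ht'] at g22 g12
  have hsq : C 1 2 ^ 2 = C 2 1 ^ 2 := by linear_combination g22 - g11
  -- The remaining 2×2 block is traceless and √κ times an orthogonal matrix: a reflection or a
  -- quarter turn. A reflection can be rotated to zero diagonal, where the sextic form equals
  -- 768α²β²κ ≠ 0.
  have hreflection : C 1 2 ≠ C 2 1 := by
    intro he
    obtain ⟨p, s, hps, e⟩ := exists_half_angle (C 1 1) (C 2 1)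
    have hW := rotation12_mem hps
    have hQ := h.conjBlocks (Q := fun _ => !![1, 0, 0; 0, p, s; 0, -s, p]) (fun _ => hW)
    have hfix : ∀ t : ℝ, !![1, 0, 0; 0, p, s; 0, -s, p] *ᵥ ![t, 0, 0] = ![t, 0, 0] := by
      intro t
      ext i
      fin_cases i <;> simp [Matrix.mulVec, dotProduct, Fin.sum_univ_three]
    have hCW : !![1, 0, 0; 0, p, s; 0, -s, p] * C * !![1, 0, 0; 0, p, s; 0, -s, p]ᵀ =
        normalBlock 0 ((p ^ 2 - s ^ 2) * C 2 1 - 2 * (p * s) * C 1 1) 0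
          ((p ^ 2 - s ^ 2) * C 2 1 - 2 * (p * s) * C 1 1) := by
      have hCe : C = !![0, 0, 0; 0, C 1 1, C 2 1; 0, C 2 1, -C 1 1] := by
        ext i j
        fin_cases i <;> fin_cases j <;> simp [a0, a1, a2, b1, b2, ht', he]
      rw [hCe, rotation12_conj_reflection e]
      simp
    rw [conjBlocks_block, crossMatrix_conj hW, crossMatrix_conj hW, hfix, hfix, hCW] at hQ
    obtain ⟨-, -, -, -, h6⟩ := hQ
    rw [normalForm_sextic] at h6
    have hd : ((p ^ 2 - s ^ 2) * C 2 1 - 2 * (p * s) * C 1 1) ^ 2 = κ := by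
      have hps' : (p ^ 2 + s ^ 2) ^ 2 = 1 := by rw [hps]; ring
      linear_combination g11 + (C 1 1 ^ 2 + C 2 1 ^ 2) * hps'
        - ((p ^ 2 - s ^ 2) * C 1 1 + 2 * (p * s) * C 2 1) * e
    generalize (p ^ 2 - s ^ 2) * C 2 1 - 2 * (p * s) * C 1 1 = d at h6 hd
    have h768 : 768 * (α ^ 2 * (β ^ 2 * κ)) = 0 := by
      rw [← hd, ← h6]
      unfold sexticForm
      ring
    have := mul_ne_zero (pow_ne_zero 2 hα) (mul_ne_zero (pow_ne_zero 2 hβ) hκ)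
    exact this (by linarith)
  have hrot : C 1 2 = -C 2 1 := (sq_eq_sq_iff_eq_or_eq_neg.1 hsq).resolve_left hreflection
  have hC11 : C 1 1 = 0 := by
    have hne : C 2 1 ≠ 0 := fun h0 => hreflection (by rw [hrot, h0, neg_zero])
    rw [hrot] at g12
    refine mul_left_cancel₀ hne ?_
    linear_combination (-1 / 2 : ℝ) * g12
  have hC : C = crossMatrix ![C 2 1, 0, 0] := by
    ext i j
    fin_cases i <;> fin_cases j <;>
      simp [crossMatrix, a0, a1, a2, b1, b2, ht', hrot, hC11]
  obtain ⟨-, -, -, h4, -⟩ := h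
  rw [hC] at h4 ⊢
  rw [crossMatrix_planar (C 2 1) 0, normalForm_quartic, neg_zero] at h4
  exact isCompatible_collinear h4

/-! ### Reduction of a general triplet -/

theorem IsEssential.exists_eq {E : Matrix (Fin 3) (Fin 3) ℝ} (h : IsEssential E)
    (hr : E.rank = 2) :
    ∃ P ∈ Matrix.specialOrthogonalGroup (Fin 3) ℝ, ∃ S ∈ Matrix.specialOrthogonalGroup (Fin 3) ℝ,
      ∃ c : Fin 3 → ℝ, c ≠ 0 ∧ E = P * crossMatrix c * Sᵀ := by
  obtain ⟨S, hS, P, hP, t₁, t₂, rfl⟩ := h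
  refine ⟨P, hP, S, hS, _, ?_, rfl⟩
  intro h0
  rw [h0, crossMatrix_zero, mul_zero, zero_mul, Matrix.rank_zero] at hr
  exact absurd hr (by norm_num)

theorem isCompatible_of_compatibilityEquations {A B C : Matrix (Fin 3) (Fin 3) ℝ}
    (hA : IsEssential A) (hrA : A.rank = 2) (hB : IsEssential B) (hrB : B.rank = 2)
    (hC : IsEssential C) (hrC : C.rank = 2) (h : CompatibilityEquations (block A B C)) :
    IsCompatible A B C := by
  obtain ⟨P, hP, S, hS, a, ha, rfl⟩ := hA.exists_eq hrA
  obtain ⟨P', hP', S', hS', b, hb, rfl⟩ := hB.exists_eq hrB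
  obtain ⟨P'', hP'', S'', hS'', c, hc, rfl⟩ := hC.exists_eq hrC
  have hSP : Sᵀ * P' ∈ Matrix.specialOrthogonalGroup (Fin 3) ℝ :=
    mul_mem (SO3_transpose hS) hP'
  obtain ⟨W, hW, α, β₁, β₂, hWa, hWb⟩ := exists_rotation_triangular a ((Sᵀ * P') *ᵥ b)
  -- Making the first block a cross-product matrix fixes the first two frames up to the common
  -- rotation W; the second block then fixes the third frame, and W is spent on triangularizing the
  -- two baselines.
  obtain ⟨Q, hQ0, hQ1, hQ2⟩ : ∃ Q : Fin 3 → Matrix (Fin 3) (Fin 3) ℝ,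
      Q 0 = W * Pᵀ ∧ Q 1 = W * Sᵀ ∧ Q 2 = W * (Sᵀ * P') * S'ᵀ :=
    ⟨![W * Pᵀ, W * Sᵀ, W * (Sᵀ * P') * S'ᵀ], rfl, rfl, rfl⟩
  have hQ : ∀ i, Q i ∈ Matrix.specialOrthogonalGroup (Fin 3) ℝ := by
    intro i
    fin_cases i
    · exact hQ0 ▸ mul_mem hW (SO3_transpose hP)
    · exact hQ1 ▸ mul_mem hW (SO3_transpose hS)
    · exact hQ2 ▸ mul_mem (mul_mem hW hSP) (SO3_transpose hS')
  refine isCompatible_of_conj hQ ?_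
  have h' := h.conjBlocks hQ
  rw [conjBlocks_block] at h'
  have eA : Q 0 * (P * crossMatrix a * Sᵀ) * (Q 1)ᵀ = crossMatrix ![α, 0, 0] := by
    rw [hQ0, hQ1, ← hWa, ← crossMatrix_conj hW]
    simp only [Matrix.transpose_mul, Matrix.transpose_transpose, mul_assoc,
      SO3_transpose_mul_cancel hP, SO3_transpose_mul_cancel hS]
  have eB : Q 1 * (P' * crossMatrix b * S'ᵀ) * (Q 2)ᵀ = crossMatrix ![β₁, β₂, 0] := by
    rw [hQ1, hQ2, ← hWb, ← crossMatrix_conj hW, ← crossMatrix_conj hSP]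
    simp only [Matrix.transpose_mul, Matrix.transpose_transpose, mul_assoc,
      SO3_transpose_mul_cancel hS']
  have eC : Q 2 * (P'' * crossMatrix c * S''ᵀ) * (Q 0)ᵀ =
      (Q 2 * P'') * crossMatrix c * (Q 0 * S'')ᵀ := by
    simp only [Matrix.transpose_mul, mul_assoc]
  have hP2 := mul_mem (hQ 2) hP''
  have hS2 := mul_mem (hQ 0) hS''
  have hWa0 := SO3_mulVec_ne_zero hW ha
  have hWb0 := SO3_mulVec_ne_zero hW (SO3_mulVec_ne_zero hSP hb)
  rw [eA, eB, eC] at h' ⊢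
  rw [hWa] at hWa0
  rw [hWb] at hWb0
  have hα : α ≠ 0 := by
    rintro rfl
    exact hWa0 (by ext i; fin_cases i <;> rfl)
  rcases eq_or_ne β₂ 0 with rfl | hβ
  · have hβ₁ : β₁ ≠ 0 := by
      rintro rfl
      exact hWb0 (by ext i; fin_cases i <;> rfl)
    exact isCompatible_of_collinear_baseline hα hβ₁ hP2 hS2 hc h'
  · exact isCompatible_of_planar_baseline hα hβ hP2 hS2 hc h'

end EssentialTriplet

theorem theorem2 (E₁₂ E₂₃ E₃₁ : Matrix (Fin 3) (Fin 3) ℝ)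
    (h₁₂ : IsEssential E₁₂) (hr₁₂ : E₁₂.rank = 2)
    (h₂₃ : IsEssential E₂₃) (hr₂₃ : E₂₃.rank = 2)
    (h₃₁ : IsEssential E₃₁) (hr₃₁ : E₃₁.rank = 2) :
    IsCompatible E₁₂ E₂₃ E₃₁ ↔
      (E₁₂ * E₂₃ * E₃₁).trace = 0 ∧
      (∀ i j k : Fin 3, i ≠ j → j ≠ k → k ≠ i →
        (block E₁₂ E₂₃ E₃₁ i j)ᵀ * block E₁₂ E₂₃ E₃₁ i j * block E₁₂ E₂₃ E₃₁ j k
          - ((1 / 2 : ℝ) * ((block E₁₂ E₂₃ E₃₁ i j)ᵀ * block E₁₂ E₂₃ E₃₁ i j).trace)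
              • block E₁₂ E₂₃ E₃₁ j k
          + (block E₁₂ E₂₃ E₃₁ i j).adjugate * (block E₁₂ E₂₃ E₃₁ k i)ᵀ = 0) ∧
      (∀ i j k : Fin 3, i ≠ j → j ≠ k → k ≠ i →
        (block E₁₂ E₂₃ E₃₁ j k)ᵀ * (block E₁₂ E₂₃ E₃₁ i j).adjugate
          + (block E₁₂ E₂₃ E₃₁ j k).adjugate * (block E₁₂ E₂₃ E₃₁ i j)ᵀ
          + diamond (block E₁₂ E₂₃ E₃₁ i j * block E₁₂ E₂₃ E₃₁ j k)
              (block E₁₂ E₂₃ E₃₁ k i)ᵀ = 0) ∧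
      (bigMatrix E₁₂ E₂₃ E₃₁ ^ 2).trace ^ 2 - 16 * (bigMatrix E₁₂ E₂₃ E₃₁ ^ 4).trace
          + 24 * (∑ i : Fin 3, ∑ j ∈ Finset.Ioi i,
              ((block E₁₂ E₂₃ E₃₁ i j)ᵀ * block E₁₂ E₂₃ E₃₁ i j).trace ^ 2) = 0 ∧
      (bigMatrix E₁₂ E₂₃ E₃₁ ^ 2).trace ^ 3
          - 12 * (bigMatrix E₁₂ E₂₃ E₃₁ ^ 2).trace * (bigMatrix E₁₂ E₂₃ E₃₁ ^ 4).trace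
          + 32 * (bigMatrix E₁₂ E₂₃ E₃₁ ^ 6).trace = 0 := by
  exact ⟨fun h => compatibilityEquations_of_isCompatible h, fun h =>
    isCompatible_of_compatibilityEquations h₁₂ hr₁₂ h₂₃ hr₂₃ h₃₁ hr₃₁ h⟩
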